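/- Let $X$ be a metric space and write $d(x_0,\dots,x_n)=\sum_{i=1}^n d(x_{i-1},x_i)$. A *sequence* in $X$ is a tuple $(x_0,\dots,x_n)$, $n\ge 0$, with $x_{i-1}\ne x_i$ for all $i$. The point $x_k$ is *smooth* in it if $1\le k\le n-1$ and $d(x_{k-1},x_k,x_{k+1})=d(x_{k-1},x_{k+1})$, and *singular* otherwise; a sequence is *singular* if all its points are singular. A *$4$-cut* is a sequence $(x_0,x_1,x_2,x_3)$ with $d(x_0,x_3)<d(x_0,x_1,x_2,x_3)=d(x_0,x_2,x_3)=d(x_0,x_1,x_3)$, and $m_X\in[0,\infty]$ is the infimum of the lengths of all $4$-cuts ($m_X=\infty$ if there are none). For $a,b\in X$ let $I[a,b]=\{x\in X\mid d(a,x,b)=d(a,b)\}$, partially ordered by $x\le y\Leftrightarrow d(a,x,y,b)=d(a,b)$, and let $I(a,b)=I[a,b]\smallsetminus\{a,b\}$. A *thin frame* is a singular sequence $(a_0,\dots,a_m)$, $m\ge 0$, with $I(a_{i-1},a_i)=\emptyset$ for $i=1,\dots,m$; its length is $d(a_0,\dots,a_m)$. Order $X\times\mathbb{R}$ by $(x,t)\le(x',t')\Leftrightarrow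 d(x,x')\le t'-t$. For $\ell\ge 0$ let $\mathrm{Cau}^\ell(X)$ be the disjoint union of posets $\bigsqcup_{a,b\in X}\{(x,t)\mid (a,0)\le(x,t)\le(b,\ell)\}$, let $\Delta\mathrm{Cau}^\ell(X)$ be its order complex (the simplicial complex of nonempty finite chains), and let $\dot\Delta\mathrm{Cau}^\ell(X)$ be the subcomplex of chains $(x_0,t_0)<\dots<(x_n,t_n)$ with $d(x_0,\dots,x_n)<\ell$. The *magnitude homotopy type* of $X$ is the quotient of geometric realizations (with the CW topology) $$\mathcal{M}^\ell(X)=|\Delta\mathrm{Cau}^\ell(X)|\,/\,|\dot\Delta\mathrm{Cau}^\ell(X)|,$$ where $Y/\emptyset=Y\sqcup\{*\}$. **Corollary.** Suppose that $m_X=\infty$ and that the poset $I[a,b]$ is totally ordered for all $a,b\in X$. Then for every real $\ell\ge 0$ there is a homotopy equivalence $$\mathcal{M}^\ell(X)\simeq\bigvee_{\substack{F=(a_0,\dots,a_m)\text{ thin frame}\\ d(F)=\ell}}S^m$$ (the empty wedge being a point). Moreover, both hypotheses, and hence the conclusion, hold if $X$ is a subset of a Euclidean space $\mathbb{R}^n$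 with the induced metric, and if $X$ is the vertex set of a (possibly infinite) tree with the shortest-path metric. -/

import Mathlib

noncomputable section

namespace MagnitudeHomotopy

/-! ### Collapsing a subspace, wedge sums, spheres -/

/-- The relation on `Y ⊔ {*}` that identifies every point of `A` with the extra point `*`. -/
def CollapseRel {Y : Type*} (A : Set Y) (p q : Y ⊕ Unit) : Prop :=
  ∃ a ∈ A, p = Sum.inl a ∧ q = Sum.inr ()

/-- The quotient space `Y / A`, with the convention `Y / ∅ = Y ⊔ {*}`. -/
def Collapse {Y : Type*} (A : Set Y) : Type _ := Quot (CollapseRel A)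

instance {Y : Type*} [TopologicalSpace Y] (A : Set Y) : TopologicalSpace (Collapse A) :=
  inferInstanceAs (TopologicalSpace (Quot (CollapseRel A)))

/-- The wedge sum of a family of spaces `Y i` with base points `y i`: the disjoint union with all
base points identified (a single point if the family is empty). -/
def Wedge {ι : Type*} (Y : ι → Type*) (y : ∀ i, Y i) : Type _ :=
  Collapse (Set.range fun i => (⟨i, y i⟩ : Σ i, Y i))

instance {ι : Type*} (Y : ι → Type*) [∀ i, TopologicalSpace (Y i)] (y : ∀ i, Y i) :
    TopologicalSpace (Wedge Y y) :=
  inferInstanceAs (TopologicalSpace (Collapse _))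

/-- The sphere `S^m`, the unit sphere of `ℝ^(m+1)`. -/
abbrev Sphere (m : ℕ) : Type := Metric.sphere (0 : EuclideanSpace ℝ (Fin (m + 1))) 1

/-- The base point `(1, 0, …, 0)` of `S^m`. -/
def Sphere.base (m : ℕ) : Sphere m :=
  ⟨EuclideanSpace.single 0 1, by simp⟩

/-! ### Geometric realization and order complexes -/

/-- A point of the geometric realization `|K|`, given by its barycentric coordinates. -/
@[ext] structure Realization {V : Type*} (K : PreAbstractSimplicialComplex V) where
  weight : V →₀ ℝ
  nonneg : ∀ v, 0 ≤ weight v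
  sum_eq_one : (weight.sum fun _ r => r) = 1
  support_mem : weight.support ∈ K.faces

/-- The closed simplex of `|K|` spanned by a finite set `σ` of vertices. -/
def closedSimplex {V : Type*} (K : PreAbstractSimplicialComplex V) (σ : Finset V) :
    Set (Realization K) :=
  {p | p.weight.support ⊆ σ}

/-- The topology of the CW complex `|K|`: every closed simplex has the Euclidean topology given by
the barycentric coordinates, and `|K|` has the weak topology with respect to its closed
simplices. -/
instance {V : Type*} (K : PreAbstractSimplicialComplex V) : TopologicalSpace (Realization K) :=
  ⨆ σ : K.faces, TopologicalSpace.coinduced (Subtype.val : closedSimplex K σ.1 → Realization K)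
    (TopologicalSpace.induced (fun p (v : V) => p.1.weight v) inferInstance)

/-- For a subcomplex `L` of `K`, the subspace `|L|` of `|K|`. -/
def subRealization {V : Type*} (K L : PreAbstractSimplicialComplex V) : Set (Realization K) :=
  {p | p.weight.support ∈ L.faces}

/-- The order complex `ΔP` of a poset `P`: its simplices are the nonempty finite chains. -/
def orderComplex (P : Type*) [PartialOrder P] : PreAbstractSimplicialComplex P where
  faces := {σ | σ.Nonempty ∧ IsChain (· ≤ ·) (σ : Set P)}
  isRelLowerSet_faces := fun _ h =>
    ⟨h.1, fun _ hts ht => ⟨ht, h.2.mono (Finset.coe_subset.2 hts)⟩⟩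

/-! ### Sequences in a metric space -/

section Sequences

variable {X : Type*} [MetricSpace X]

/-- The length `d(x_0, …, x_n) = d(x_0, x_1) + ⋯ + d(x_{n-1}, x_n)`. -/
def seqLength {n : ℕ} (x : Fin (n + 1) → X) : ℝ :=
  ∑ i : Fin n, dist (x i.castSucc) (x i.succ)

/-- Sequences are required to have distinct consecutive members. -/
def IsSeq {n : ℕ} (x : Fin (n + 1) → X) : Prop :=
  ∀ i : Fin n, x i.castSucc ≠ x i.succ

/-- `x_k` is smooth: `1 ≤ k ≤ n - 1` and `d(x_{k-1}, x_k, x_{k+1}) = d(x_{k-1}, x_{k+1})`. -/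
def IsSmoothAt {n : ℕ} (x : Fin (n + 1) → X) (k : Fin (n + 1)) : Prop :=
  ∃ i j : Fin (n + 1), (i : ℕ) + 1 = k ∧ (k : ℕ) + 1 = j ∧
    dist (x i) (x k) + dist (x k) (x j) = dist (x i) (x j)

/-- A singular sequence: none of its points is smooth. -/
def IsSingularSeq {n : ℕ} (x : Fin (n + 1) → X) : Prop :=
  IsSeq x ∧ ∀ k, ¬ IsSmoothAt x k

/-- A `4`-cut: a sequence `(x_0, x_1, x_2, x_3)` with
`d(x_0, x_3) < d(x_0, x_1, x_2, x_3) = d(x_0, x_2, x_3) = d(x_0, x_1, x_3)`. -/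
def IsFourCut (x : Fin 4 → X) : Prop :=
  IsSeq x ∧ dist (x 0) (x 3) < seqLength x ∧
    seqLength x = seqLength ![x 0, x 2, x 3] ∧ seqLength x = seqLength ![x 0, x 1, x 3]

variable (X) in
/-- `m_X`, the infimum of the lengths of all `4`-cuts (`∞` if there are none). -/
def fourCutInf : EReal :=
  ⨅ (x : Fin 4 → X) (_ : IsFourCut x), (seqLength x : EReal)

/-- The interval `I[a, b]`. -/
def closedInterval (a b : X) : Set X :=
  {x | dist a x + dist x b = dist a b}

/-- The interval `I(a, b) = I[a, b] ∖ {a, b}`. -/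
def openInterval (a b : X) : Set X :=
  closedInterval a b \ {a, b}

/-- The interval `I[a, b]` as a poset, where `x ≤ y` means `d(a, x, y, b) = d(a, b)`. -/
def IntervalPoset (a b : X) : Type _ := closedInterval a b

instance (a b : X) : PartialOrder (IntervalPoset a b) where
  le x y := dist a x.1 + dist x.1 y.1 + dist y.1 b = dist a b
  le_refl x := by
    have h : dist a x.1 + dist x.1 b = dist a b := x.2
    simpa using h
  le_trans x y z hxy hyz := by
    have h1 := dist_triangle a y.1 b
    have h2 := dist_triangle a x.1 y.1
    have h3 := dist_triangle x.1 y.1 z.1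
    have h4 := dist_triangle4 a x.1 z.1 b
    linarith
  le_antisymm x y hxy hyx := by
    have h1 := dist_triangle a x.1 b
    have h2 := dist_triangle a y.1 b
    have h3 := dist_triangle a x.1 y.1
    have h4 := dist_triangle a y.1 x.1
    have h5 := dist_comm x.1 y.1
    have h6 := dist_nonneg (x := x.1) (y := y.1)
    have hx : dist a x.1 + dist x.1 b = dist a b := x.2
    have hy : dist a y.1 + dist y.1 b = dist a b := y.2
    exact Subtype.ext (dist_le_zero.1 (by linarith))

/-- A thin frame: a singular sequence `(a_0, …, a_m)` with `I(a_{i-1}, a_i) = ∅` for all `i`. -/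
def IsThinFrame {m : ℕ} (F : Fin (m + 1) → X) : Prop :=
  IsSingularSeq F ∧ ∀ i : Fin m, openInterval (F i.castSucc) (F i.succ) = ∅

variable (X) in
/-- The thin frames of length `ℓ`; the first component of `F` is the number `m` in
`(a_0, …, a_m)`. -/
def ThinFrame (ℓ : ℝ) : Type _ :=
  Σ m : ℕ, {F : Fin (m + 1) → X // IsThinFrame F ∧ seqLength F = ℓ}

/-- Passing to a subsequence does not increase the length. -/
theorem seqLength_comp_le {k n : ℕ} (x : Fin (n + 1) → X) (f : Fin (k + 1) → Fin (n + 1))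
    (hf : Monotone f) : seqLength (x ∘ f) ≤ seqLength x := by
  let g : ℕ → X := fun i => x ⟨min i n, by omega⟩
  let f' : ℕ → ℕ := fun i => f ⟨min i k, by omega⟩
  have hf' : Monotone f' := fun i j hij => hf (by
    simp only [Fin.mk_le_mk]; omega)
  have h1 : seqLength x = ∑ i ∈ Finset.range n, dist (g i) (g (i + 1)) := by
    rw [Finset.sum_range]
    refine Finset.sum_congr rfl fun i _ => ?_
    have := i.2
    congr 2 <;> ext <;> simp
  have hg : ∀ j : Fin (n + 1), g j = x j := fun j => by
    have := j.2
    simp only [g]; congr 1; ext; simp; omega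
  have h2 : seqLength (x ∘ f) = ∑ i ∈ Finset.range k, dist (g (f' i)) (g (f' (i + 1))) := by
    rw [Finset.sum_range]
    refine Finset.sum_congr rfl fun i _ => ?_
    have := i.2
    simp only [f', hg, Function.comp]
    congr 3 <;> ext <;> simp
  have h3 : ∀ j, ∑ i ∈ Finset.range j, dist (g (f' i)) (g (f' (i + 1))) ≤
      ∑ i ∈ Finset.Ico (f' 0) (f' j), dist (g i) (g (i + 1)) := by
    intro j
    induction j with
    | zero => simp
    | succ j ih =>
      rw [Finset.sum_range_succ, ← Finset.sum_Ico_consecutive _ (hf' (Nat.zero_le j))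
        (hf' (Nat.le_succ j))]
      exact add_le_add ih (dist_le_Ico_sum_dist g (hf' (Nat.le_succ j)))
  rw [h1, h2]
  refine (h3 k).trans (Finset.sum_le_sum_of_subset_of_nonneg ?_ fun _ _ _ => dist_nonneg)
  intro i hi
  have := (f ⟨min k k, by omega⟩).2
  simp only [Finset.mem_Ico, Finset.mem_range, f'] at hi ⊢
  omega

end Sequences

/-! ### The causal order and the magnitude homotopy type -/

/-- The spacetime `X × ℝ`. -/
@[ext] structure Spacetime (X : Type*) where
  point : X
  time : ℝ

/-- The causal order: `(x, t) ≤ (x', t')` if and only if `d(x, x') ≤ t' - t`. -/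
instance (X : Type*) [MetricSpace X] : PartialOrder (Spacetime X) where
  le p q := dist p.point q.point ≤ q.time - p.time
  le_refl p := by simp
  le_trans p q r hpq hqr := by
    have := dist_triangle p.point q.point r.point
    linarith
  le_antisymm p q hpq hqp := by
    have h := dist_comm p.point q.point
    have h0 := dist_nonneg (x := p.point) (y := q.point)
    exact Spacetime.ext (dist_le_zero.1 (by linarith)) (by linarith)

/-- The causal interval between `(a, 0)` and `(b, ℓ)`. -/
abbrev Causal (X : Type*) [MetricSpace X] (ℓ : ℝ) (a b : X) : Type _ :=
  Set.Icc (⟨a, 0⟩ : Spacetime X) ⟨b, ℓ⟩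

/-- The total causal poset: the disjoint union of the causal intervals over all `(a, b)`, elements
of different intervals being incomparable. -/
abbrev TotalCausal (X : Type*) [MetricSpace X] (ℓ : ℝ) : Type _ :=
  Σ p : X × X, Causal X ℓ p.1 p.2

/-- The subcomplex of the order complex of the total causal poset consisting of the chains
`(x_0, t_0) < ⋯ < (x_n, t_n)` with `d(x_0, …, x_n) < ℓ`. -/
def shortComplex (X : Type*) [MetricSpace X] (ℓ : ℝ) :
    PreAbstractSimplicialComplex (TotalCausal X ℓ) where
  faces := {σ | ∃ (n : ℕ) (z : Fin (n + 1) → TotalCausal X ℓ), StrictMono z ∧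
    (σ : Set (TotalCausal X ℓ)) = Set.range z ∧ seqLength (fun i => (z i).2.1.point) < ℓ}
  isRelLowerSet_faces := by
    classical
    rintro σ ⟨n, z, hz, hσ, hlen⟩
    refine ⟨?_, fun τ hτσ hτ => ?_⟩
    · rw [← Finset.coe_nonempty, hσ]
      exact Set.range_nonempty z
    · have hsub : ∀ v ∈ τ, ∃ i, z i = v := fun v hv => by
        have : v ∈ (σ : Set _) := hτσ hv
        rwa [hσ] at this
      let T : Finset (Fin (n + 1)) := Finset.univ.filter fun i => z i ∈ τ
      have hT : T.Nonempty := by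
        obtain ⟨v, hv⟩ := hτ
        obtain ⟨i, hi⟩ := hsub v hv
        exact ⟨i, by simp [T, hi, hv]⟩
      obtain ⟨k, hk⟩ : ∃ k, T.card = k + 1 :=
        Nat.exists_eq_succ_of_ne_zero (Finset.card_pos.2 hT).ne'
      let f := T.orderEmbOfFin hk
      refine ⟨k, z ∘ f, hz.comp f.strictMono, ?_, ?_⟩
      · rw [Set.range_comp, Finset.range_orderEmbOfFin]
        ext v
        simp only [Finset.mem_coe, Set.mem_image]
        constructor
        · intro hv
          obtain ⟨i, rfl⟩ := hsub v hv
          exact ⟨i, by simp [T, hv], rfl⟩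
        · rintro ⟨i, hi, rfl⟩
          simpa [T] using hi
      · exact (seqLength_comp_le (fun i => (z i).2.1.point) f f.monotone).trans_lt hlen

/-- The total magnitude homotopy type `M^ℓ(X)`: the realization of the order complex of the total
causal poset modulo the subcomplex of short chains. -/
abbrev MagnitudeHomotopyType (X : Type*) [MetricSpace X] (ℓ : ℝ) : Type _ :=
  Collapse (subRealization (orderComplex (TotalCausal X ℓ)) (shortComplex X ℓ))

/-- The wedge of spheres `S^m`, one for each thin frame `(a_0, …, a_m)` of length `ℓ`. -/
abbrev ThinFrameWedge (X : Type*) [MetricSpace X] (ℓ : ℝ) : Type _ :=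
  Wedge (fun F : ThinFrame X ℓ => Sphere F.1) fun F => Sphere.base F.1

end MagnitudeHomotopy

end

open Topology

noncomputable section

namespace MagnitudeHomotopy

/-! Call two comparable points of the causal poset null related if their distance equals their time
difference. A chain has length at most `ℓ`, with equality exactly when it runs from time `0` to time
`ℓ` by null steps; these full chains are the simplices outside the short subcomplex. The frame of a
full chain is the set of its singular points, those not straddled by a null related pair of the
chain.

Two facts about the null relation drive everything: overlapping null pairs glue, since a failure
would be a `4`-cut, and points inside a null pair are comparable, since intervals are totally
ordered (`isNullRel_null`). Gluing shows that a full chain and any chain containing it have the same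
frame (`IsFull.frame_eq`), and that deleting all smooth points leaves a full chain
(`IsFull.frame_isFull`). If some point `p` lies inside a null pair of the frame, it can be added to
every full chain with that frame, without changing fullness or frame. Choosing `p` as a function of
the frame alone gives all these chains the same cone vertex. The straight-line contraction towards
it is thus compatible with faces, preserves the short subcomplex, and ends at a short vertex, so
modulo short chains these simplices contract to the base point.

The remaining full chains have no such `p`. They equal their frames, are maximal simplices, and have
all proper faces short; hence each contributes `Δ^m / ∂Δ^m = S^m`. Recording initial lengths as
times identifies thin frames of length `ℓ` with these chains (`causalSeq_isCritical`,
`exists_causalSeq_of_isCritical`). `ConeMatching` isolates the topological part of the argument, and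
`coneMatching_of_isNullRel` the order-theoretic part.

In Euclidean space the hypotheses follow from strict convexity, in a tree from uniqueness of paths.
-/

/-! ### The simplex modulo its boundary -/

section SimplexSphere

variable {m : ℕ}

/-- Logarithmic coordinates on the open simplex. -/
def simplexLog (x : Fin (m + 1) → ℝ) : Fin m → ℝ :=
  fun j => Real.log (x j.succ) - Real.log (x 0)

/-- The inverse of `simplexLog`, with values in the open simplex. -/
def softmax (v : Fin m → ℝ) : Fin (m + 1) → ℝ :=
  fun i => Real.exp ((Fin.cons 0 v : Fin (m + 1) → ℝ) i) /
    ∑ k, Real.exp ((Fin.cons 0 v : Fin (m + 1) → ℝ) k)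

theorem sum_exp_pos (v : Fin (m + 1) → ℝ) : 0 < ∑ k, Real.exp (v k) :=
  Finset.sum_pos (fun _ _ => Real.exp_pos _) Finset.univ_nonempty

theorem softmax_pos (v : Fin m → ℝ) (i : Fin (m + 1)) : 0 < softmax v i :=
  div_pos (Real.exp_pos _) (sum_exp_pos _)

theorem softmax_mem (v : Fin m → ℝ) : softmax v ∈ stdSimplex ℝ (Fin (m + 1)) := by
  refine ⟨fun i => (softmax_pos v i).le, ?_⟩
  simp only [softmax]
  rw [← Finset.sum_div, div_self (sum_exp_pos _).ne']

theorem continuous_softmax : Continuous (softmax : (Fin m → ℝ) → _) := by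
  refine continuous_pi fun i => ?_
  have h : ∀ k, Continuous fun v : Fin m → ℝ =>
      Real.exp ((Fin.cons 0 v : Fin (m + 1) → ℝ) k) := fun k => by
    refine Real.continuous_exp.comp ?_
    refine Fin.cases ?_ (fun j => ?_) k
    · simpa using continuous_const
    · simpa using continuous_apply j
  exact (h i).div (continuous_finsetSum _ fun k _ => h k) fun v => (sum_exp_pos _).ne'

theorem simplexLog_softmax (v : Fin m → ℝ) : simplexLog (softmax v) = v := by
  funext j
  simp only [simplexLog, softmax]
  rw [Real.log_div (Real.exp_pos _).ne' (sum_exp_pos _).ne',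
    Real.log_div (Real.exp_pos _).ne' (sum_exp_pos _).ne', Real.log_exp, Real.log_exp]
  simp

theorem softmax_simplexLog {x : Fin (m + 1) → ℝ} (hx : x ∈ stdSimplex ℝ (Fin (m + 1)))
    (h0 : ∀ j, x j ≠ 0) : softmax (simplexLog x) = x := by
  have hpos : ∀ j, 0 < x j := fun j => lt_of_le_of_ne (hx.1 j) (h0 j).symm
  have h : ∀ k, Real.exp ((Fin.cons 0 (simplexLog x) : Fin (m + 1) → ℝ) k) = x k / x 0 := by
    intro k
    refine Fin.cases ?_ (fun j => ?_) k
    · simp [h0]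
    · simp [simplexLog, Real.exp_sub, Real.exp_log, hpos]
  funext i
  simp only [softmax, h]
  rw [← Finset.sum_div, hx.2]
  have := h0 0
  field_simp

open Classical in
/-- The collapse of the boundary of the simplex to a point, in logarithmic coordinates. -/
def simplexToOnePoint (x : stdSimplex ℝ (Fin (m + 1))) : OnePoint (Fin m → ℝ) :=
  if ∃ j, x.1 j = 0 then OnePoint.infty else OnePoint.some (simplexLog x.1)

/-- For a neighbourhood of infinity, the complement of the preimage is the image under `softmax` of
a compact set, hence closed. For other open sets, continuity of the logarithm on the open simplex is
enough. -/
theorem continuous_simplexToOnePoint :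
    Continuous (simplexToOnePoint : stdSimplex ℝ (Fin (m + 1)) → _) := by
  have hU : IsOpen {x : stdSimplex ℝ (Fin (m + 1)) | ∀ j, x.1 j ≠ 0} := by
    simp only [Set.ofPred_forall]
    exact isOpen_iInter_of_finite fun j =>
      isOpen_ne_fun ((continuous_apply j).comp continuous_subtype_val) continuous_const
  have hlog : ContinuousOn (fun x : stdSimplex ℝ (Fin (m + 1)) => simplexLog x.1)
      {x | ∀ j, x.1 j ≠ 0} := by
    refine continuousOn_pi.2 fun j => ?_
    exact ContinuousOn.sub
      (ContinuousOn.log ((continuous_apply _).comp continuous_subtype_val).continuousOn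
        fun x hx => hx _)
      (ContinuousOn.log ((continuous_apply _).comp continuous_subtype_val).continuousOn
        fun x hx => hx _)
  refine continuous_def.2 fun s hs => ?_
  by_cases h : OnePoint.infty ∈ s
  · rw [OnePoint.isOpen_iff_of_mem h] at hs
    have hK : IsCompact ((fun v : Fin m → ℝ =>
        (⟨softmax v, softmax_mem v⟩ : stdSimplex ℝ (Fin (m + 1)))) '' (OnePoint.some ⁻¹' s)ᶜ) :=
      hs.2.image (continuous_softmax.subtype_mk _)
    convert hK.isClosed.isOpen_compl using 1
    ext x
    simp only [Set.mem_preimage, Set.mem_compl_iff, Set.mem_image, not_exists, not_and,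
      simplexToOnePoint]
    split_ifs with hx
    · obtain ⟨j, hj⟩ := hx
      simp only [h, true_iff]
      rintro v - rfl
      exact (softmax_pos v j).ne' hj
    · push Not at hx
      constructor
      · rintro hxs v hv rfl
        exact hv (by simpa [simplexLog_softmax] using hxs)
      · intro H
        by_contra hxs
        exact H _ hxs (Subtype.ext (softmax_simplexLog x.2 hx))
  · rw [OnePoint.isOpen_iff_of_notMem h] at hs
    convert hlog.isOpen_inter_preimage hU hs using 1
    ext x
    simp only [Set.mem_preimage, simplexToOnePoint, Set.mem_inter_iff, Set.mem_ofPred_eq]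
    split_ifs with hx
    · simp only [h, false_iff, not_and]
      exact fun H => (hx.elim fun j hj => (H j hj).elim)
    · push Not at hx
      simp [hx]

theorem norm_sphere_base (m : ℕ) : ‖(Sphere.base m).1‖ = 1 := by simp [Sphere.base]

/-- Stereographic projection from the base point, after a linear identification of `ℝ^m` with the
orthogonal hyperplane. -/
theorem exists_onePoint_homeo_sphere (m : ℕ) :
    ∃ e : OnePoint (Fin m → ℝ) ≃ₜ Sphere m, e OnePoint.infty = Sphere.base m := by
  have hv := norm_sphere_base m
  have hv₀ : (Sphere.base m).1 ≠ 0 := fun h => by simp [h] at hv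
  have : Fact (Module.finrank ℝ (EuclideanSpace ℝ (Fin (m + 1))) = m + 1) := ⟨by simp⟩
  have hV : Module.finrank ℝ (Fin m → ℝ) =
      Module.finrank ℝ (Submodule.span ℝ {(Sphere.base m).1})ᗮ := by
    rw [Submodule.finrank_orthogonal_span_singleton (n := m) hv₀]; simp
  let e : (Fin m → ℝ) ≃ₜ (Submodule.span ℝ {(Sphere.base m).1})ᗮ :=
    (FiniteDimensional.nonempty_continuousLinearEquiv_of_finrank_eq hV).some.toHomeomorph
  refine ⟨e.onePointCongr.trans (onePointHyperplaneHomeoUnitSphere hv), ?_⟩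
  have h := OnePoint.equivOfIsEmbeddingOfRangeEq_apply_infty _ _
    (isOpenEmbedding_stereographic_symm hv).toIsEmbedding (range_stereographic_symm hv (Sphere.base m).2)
  exact h

/-- The one-point compactification of `ℝ^m` is the sphere, with base point at infinity. -/
def sphereHomeo (m : ℕ) : OnePoint (Fin m → ℝ) ≃ₜ Sphere m :=
  (exists_onePoint_homeo_sphere m).choose

theorem sphereHomeo_infty (m : ℕ) : sphereHomeo m OnePoint.infty = Sphere.base m :=
  (exists_onePoint_homeo_sphere m).choose_spec

/-- The collapse of the boundary of the simplex to the base point of the sphere. -/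
def simplexToSphere (x : stdSimplex ℝ (Fin (m + 1))) : Sphere m :=
  sphereHomeo m (simplexToOnePoint x)

theorem continuous_simplexToSphere :
    Continuous (simplexToSphere : stdSimplex ℝ (Fin (m + 1)) → _) :=
  (Homeomorph.continuous _).comp continuous_simplexToOnePoint

theorem simplexToSphere_eq_base_iff (x : stdSimplex ℝ (Fin (m + 1))) :
    simplexToSphere x = Sphere.base m ↔ ∃ j, x.1 j = 0 := by
  rw [simplexToSphere, ← sphereHomeo_infty,
    (Homeomorph.injective _).eq_iff, simplexToOnePoint]
  split_ifs with h <;> simp [h]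

theorem simplexToSphere_injOn {x y : stdSimplex ℝ (Fin (m + 1))} (hx : ∀ j, x.1 j ≠ 0)
    (h : simplexToSphere x = simplexToSphere y) : x = y := by
  have hx' : ¬ ∃ j, x.1 j = 0 := fun ⟨j, hj⟩ => hx j hj
  have hy' : ¬ ∃ j, y.1 j = 0 := by
    rwa [← simplexToSphere_eq_base_iff, ← h, simplexToSphere_eq_base_iff]
  replace h := (Homeomorph.injective _) h
  rw [simplexToOnePoint, simplexToOnePoint, if_neg hx', if_neg hy', OnePoint.coe_eq_coe] at h
  push Not at hx' hy'
  rw [Subtype.ext_iff, ← softmax_simplexLog x.2 hx', h, softmax_simplexLog y.2 hy']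

theorem exists_simplexToSphere_eq {y : Sphere m} (hy : y ≠ Sphere.base m) :
    ∃ x, simplexToSphere x = y := by
  obtain ⟨p, rfl⟩ := (sphereHomeo m).surjective y
  rw [← sphereHomeo_infty, (Homeomorph.injective _).ne_iff,
    OnePoint.ne_infty_iff_exists] at hy
  obtain ⟨v, rfl⟩ := hy
  refine ⟨⟨softmax v, softmax_mem v⟩, ?_⟩
  rw [simplexToSphere, simplexToOnePoint,
    if_neg (by rintro ⟨j, hj⟩; exact (softmax_pos v j).ne' hj), simplexLog_softmax]

/-- The sphere is the quotient `Δ^m / ∂Δ^m`, where `Δ^0 / ∅` is a disjoint union. -/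
theorem isQuotientMap_simplexToSphere : IsQuotientMap
    (Sum.elim simplexToSphere fun _ => Sphere.base m :
      stdSimplex ℝ (Fin (m + 1)) ⊕ Unit → Sphere m) := by
  -- A continuous surjection from a compact space to a Hausdorff space is a quotient map. The
  -- summand `Unit` supplies the base point, which the simplex misses when `m = 0`.
  refine IsQuotientMap.of_surjective_continuous (fun y => ?_)
    (continuous_simplexToSphere.sumElim continuous_const)
  by_cases hy : y = Sphere.base m
  · exact ⟨Sum.inr (), hy.symm⟩
  · obtain ⟨x, hx⟩ := exists_simplexToSphere_eq hy
    exact ⟨Sum.inl x, hx⟩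

end SimplexSphere

/-! ### Continuity on realizations and collapses -/

section Collapse

variable {Y : Type*} {A : Set Y}

/-- The class of a point in `Y / A`. -/
def Collapse.mk (A : Set Y) (y : Y) : Collapse A := Quot.mk _ (Sum.inl y)

/-- The base point of `Y / A`. -/
def Collapse.pt (A : Set Y) : Collapse A := Quot.mk _ (Sum.inr ())

theorem Collapse.mk_eq_pt {y : Y} (hy : y ∈ A) : Collapse.mk A y = Collapse.pt A :=
  Quot.sound ⟨y, hy, rfl, rfl⟩

theorem Collapse.ind {p : Collapse A → Prop} (h : ∀ y, p (mk A y)) (h0 : p (pt A)) :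
    ∀ x, p x := by
  rintro ⟨y | ⟨⟨⟩⟩⟩
  exacts [h y, h0]

/-- A map out of `Y / A`. -/
def Collapse.lift {Z : Type*} (f : Y → Z) (z : Z) (h : ∀ a ∈ A, f a = z) : Collapse A → Z :=
  Quot.lift (Sum.elim f fun _ => z) (by rintro _ _ ⟨a, ha, rfl, rfl⟩; exact h a ha)

variable [TopologicalSpace Y]

theorem Collapse.continuous_mk : Continuous (Collapse.mk A) :=
  continuous_quot_mk.comp continuous_inl

theorem Collapse.continuous_lift {Z : Type*} [TopologicalSpace Z] {f : Y → Z} {z : Z}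
    (h : ∀ a ∈ A, f a = z) (hf : Continuous f) : Continuous (Collapse.lift f z h) :=
  continuous_quot_lift _ (hf.sumElim continuous_const)

end Collapse

/-! ### Weak topology of a realization, and segments towards a vertex. -/

section Realization

variable {V : Type*} {K : PreAbstractSimplicialComplex V}

variable (K) in
/-- The closed simplex of `|K|` spanned by `σ`, with the topology of barycentric coordinates. -/
def CoordSimplex (σ : Finset V) : Type _ := closedSimplex K σ

instance (σ : Finset V) : TopologicalSpace (CoordSimplex K σ) :=
  TopologicalSpace.induced (fun p (v : V) => p.1.weight v) inferInstance

theorem CoordSimplex.continuous_weight (σ : Finset V) (v : V) :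
    Continuous fun p : CoordSimplex K σ => p.1.weight v :=
  (continuous_apply v).comp continuous_induced_dom

theorem CoordSimplex.continuous_val {σ : Finset V} (hσ : σ ∈ K.faces) :
    Continuous fun p : CoordSimplex K σ => p.1 := by
  refine continuous_iff_coinduced_le.2 ?_
  exact le_iSup (fun σ : K.faces => TopologicalSpace.coinduced
    (Subtype.val : closedSimplex K σ.1 → Realization K)
    (TopologicalSpace.induced (fun p (v : V) => p.1.weight v) inferInstance)) ⟨σ, hσ⟩

theorem Realization.continuous_of_simplex {Z : Type*} [TopologicalSpace Z]
    {f : Realization K → Z}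
    (h : ∀ σ ∈ K.faces, Continuous fun p : CoordSimplex K σ => f p.1) : Continuous f := by
  refine continuous_iSup_dom.2 fun σ => ?_
  refine continuous_coinduced_dom.2 ?_
  exact h σ.1 σ.2

/-- The common simplex `σ` is what makes coordinatewise continuity suffice: on a single closed
simplex the topology is that of the coordinates, whereas the weak topology of `|K|` can be finer. -/
theorem Realization.continuous_of_weight {T : Type*} [TopologicalSpace T] {g : T → Realization K}
    {σ : Finset V} (hσ : σ ∈ K.faces) (hg : ∀ t, (g t).weight.support ⊆ σ)
    (hw : ∀ v, Continuous fun t => (g t).weight v) : Continuous g := by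
  let g' : T → CoordSimplex K σ := fun t => ⟨g t, hg t⟩
  have : Continuous g' := continuous_induced_rng.2 (continuous_pi hw)
  exact (CoordSimplex.continuous_val hσ).comp this

theorem face_mono {σ τ : Finset V} (hσ : σ ∈ K.faces) (h : τ ⊆ σ) (hτ : τ.Nonempty) :
    τ ∈ K.faces :=
  (K.isRelLowerSet_faces hσ).2 h hτ

theorem face_nonempty {σ : Finset V} (hσ : σ ∈ K.faces) : σ.Nonempty :=
  (K.isRelLowerSet_faces hσ).1

theorem Realization.sum_weight (p : Realization K) {σ : Finset V} (h : p.weight.support ⊆ σ) :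
    ∑ v ∈ σ, p.weight v = 1 := by
  rw [← p.sum_eq_one]
  exact (Finsupp.sum_of_support_subset _ h (fun _ r => r) fun _ _ => rfl).symm

theorem Realization.sum_join_weight (p : Realization K) (v : V) (s : ℝ) :
    (((1 - s) • p.weight + Finsupp.single v s).sum fun _ r => r) = 1 := by
  rw [Finsupp.sum_add_index' (fun _ => rfl) (fun _ _ _ => rfl),
    Finsupp.sum_smul_index' (fun _ => rfl), Finsupp.sum_single_index rfl]
  simp only [smul_eq_mul, Finsupp.sum]
  rw [← Finset.mul_sum, p.sum_weight (σ := p.weight.support) subset_rfl]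
  ring

variable [DecidableEq V]

theorem join_support_subset (w : V →₀ ℝ) (v : V) (s : ℝ) :
    ((1 - s) • w + Finsupp.single v s).support ⊆ insert v w.support := by
  intro x hx
  rw [Finset.mem_insert, Finsupp.mem_support_iff]
  by_contra! h
  rw [Finsupp.mem_support_iff] at hx
  exact hx (by simp [h.2, h.1.symm])

/-- The point `(1 - s) p + s v` on the segment from `p` to the vertex `v`. -/
def Realization.join (p : Realization K) (v : V) (h : insert v p.weight.support ∈ K.faces)
    (s : unitInterval) : Realization K where
  weight := (1 - (s : ℝ)) • p.weight + Finsupp.single v (s : ℝ)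
  nonneg x := by
    have h1 := p.nonneg x
    have h2 := s.2.2
    have h3 := s.2.1
    simp only [Finsupp.add_apply, Finsupp.smul_apply, smul_eq_mul, Finsupp.single_apply]
    split_ifs <;> nlinarith
  sum_eq_one := p.sum_join_weight v s
  support_mem := by
    refine face_mono h (join_support_subset _ _ _) ?_
    by_contra hne
    rw [Finset.not_nonempty_iff_eq_empty, Finsupp.support_eq_empty] at hne
    have h1 := p.sum_join_weight v s
    rw [hne] at h1
    simp at h1

theorem Realization.join_congr (p : Realization K) {v v' : V} (hv : v = v')
    (h : insert v p.weight.support ∈ K.faces) (h' : insert v' p.weight.support ∈ K.faces)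
    (s : unitInterval) : p.join v h s = p.join v' h' s := by
  subst hv; rfl

theorem Realization.join_zero (p : Realization K) (v : V)
    (h : insert v p.weight.support ∈ K.faces) : p.join v h 0 = p := by
  ext1; simp [join]

theorem Realization.join_one_weight (p : Realization K) (v : V)
    (h : insert v p.weight.support ∈ K.faces) : (p.join v h 1).weight = Finsupp.single v 1 := by
  simp [join]

end Realization

/-! ### Barycentric coordinates on one indexed simplex. -/

section SimplexPoint

variable {V : Type*} {K : PreAbstractSimplicialComplex V}
variable {m : ℕ} {z : Fin (m + 1) ↪ V}

/-- The vertex set of an indexed simplex. -/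
abbrev vertexSet (z : Fin (m + 1) ↪ V) : Finset V := Finset.univ.map z

/-- The point of a simplex with given barycentric coordinates. -/
def simplexPoint (z : Fin (m + 1) ↪ V) (hz : vertexSet z ∈ K.faces)
    (x : stdSimplex ℝ (Fin (m + 1))) : Realization K where
  weight := Finsupp.embDomain z (Finsupp.equivFunOnFinite.symm x.1)
  nonneg v := by
    by_cases h : v ∈ Set.range z
    · obtain ⟨i, rfl⟩ := h
      simpa using x.2.1 i
    · rw [Finsupp.embDomain_of_notMem_range _ _ _ h]
  sum_eq_one := by
    rw [Finsupp.sum_embDomain, Finsupp.sum_fintype _ _ fun _ => rfl]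
    exact x.2.2
  support_mem := by
    rw [Finsupp.support_embDomain]
    refine face_mono hz (Finset.map_subset_map.2 (Finset.subset_univ _)) ?_
    rw [Finset.map_nonempty]
    by_contra hne
    rw [Finset.not_nonempty_iff_eq_empty, Finsupp.support_eq_empty] at hne
    have h0 : x.1 = 0 := by
      funext i; exact DFunLike.congr_fun hne i
    have := x.2.2
    simp [h0] at this

theorem simplexPoint_weight (hz : vertexSet z ∈ K.faces) (x : stdSimplex ℝ (Fin (m + 1)))
    (i : Fin (m + 1)) : (simplexPoint z hz x).weight (z i) = x.1 i := by
  simp [simplexPoint]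

theorem simplexPoint_support_subset (hz : vertexSet z ∈ K.faces)
    (x : stdSimplex ℝ (Fin (m + 1))) :
    (simplexPoint z hz x).weight.support ⊆ vertexSet z := by
  simp only [simplexPoint, Finsupp.support_embDomain]
  exact Finset.map_subset_map.2 (Finset.subset_univ _)

theorem simplexPoint_support_eq_iff (hz : vertexSet z ∈ K.faces)
    (x : stdSimplex ℝ (Fin (m + 1))) :
    (simplexPoint z hz x).weight.support = vertexSet z ↔ ¬ ∃ j, x.1 j = 0 := by
  simp only [simplexPoint, Finsupp.support_embDomain, vertexSet, Finset.map_inj]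
  simp [Finset.ext_iff]

theorem continuous_simplexPoint (hz : vertexSet z ∈ K.faces) :
    Continuous (simplexPoint z hz) := by
  refine Realization.continuous_of_weight hz (simplexPoint_support_subset hz) fun v => ?_
  by_cases h : v ∈ Set.range z
  · obtain ⟨i, rfl⟩ := h
    simp only [simplexPoint_weight]
    exact (continuous_apply i).comp continuous_subtype_val
  · simp only [simplexPoint, Finsupp.embDomain_of_notMem_range _ _ _ h]
    exact continuous_const

/-- The barycentric coordinates of a point of a simplex. -/
def simplexCoord (z : Fin (m + 1) ↪ V) (p : CoordSimplex K (vertexSet z)) :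
    stdSimplex ℝ (Fin (m + 1)) :=
  ⟨fun i => p.1.weight (z i), fun _ => p.1.nonneg _, by
    rw [← p.1.sum_weight p.2, Finset.sum_map]⟩

theorem continuous_simplexCoord :
    Continuous (simplexCoord (K := K) z) :=
  Continuous.subtype_mk (continuous_pi fun i => CoordSimplex.continuous_weight _ (z i)) _

theorem support_eq_vertexSet_iff (p : CoordSimplex K (vertexSet z)) :
    p.1.weight.support = vertexSet z ↔ ¬ ∃ j, (simplexCoord z p).1 j = 0 := by
  constructor
  · rintro h ⟨j, hj⟩
    have : z j ∈ p.1.weight.support := by rw [h]; simp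
    exact (Finsupp.mem_support_iff.1 this) hj
  · intro h
    push Not at h
    refine Finset.Subset.antisymm p.2 fun v hv => ?_
    obtain ⟨i, -, rfl⟩ := Finset.mem_map.1 hv
    exact Finsupp.mem_support_iff.2 (h i)

theorem simplexPoint_simplexCoord (hz : vertexSet z ∈ K.faces)
    (p : CoordSimplex K (vertexSet z)) : simplexPoint z hz (simplexCoord z p) = p.1 := by
  ext v
  by_cases h : v ∈ Set.range z
  · obtain ⟨i, rfl⟩ := h
    rw [simplexPoint_weight]; rfl
  · simp only [simplexPoint, Finsupp.embDomain_of_notMem_range _ _ _ h]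
    refine (Finsupp.notMem_support_iff.1 fun hv => h ?_).symm
    obtain ⟨i, -, hi⟩ := Finset.mem_map.1 (p.2 hv)
    exact ⟨i, hi⟩

theorem simplexCoord_simplexPoint (hz : vertexSet z ∈ K.faces)
    (x : stdSimplex ℝ (Fin (m + 1))) :
    simplexCoord z ⟨simplexPoint z hz x, simplexPoint_support_subset hz x⟩ = x :=
  Subtype.ext (funext fun i => simplexPoint_weight hz x i)

end SimplexPoint

/-! ### Collapsing the noncritical simplices -/

section Wedge

variable {ι : Type*} {m : ι → ℕ}

/-- The wedge of spheres of dimensions `m i`. -/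
abbrev SphereWedge (m : ι → ℕ) : Type _ :=
  Wedge (fun i => Sphere (m i)) fun i => Sphere.base (m i)

/-- The base point of a wedge of spheres. -/
def SphereWedge.pt (m : ι → ℕ) : SphereWedge m := Collapse.pt _

/-- The inclusion of a sphere into a wedge of spheres. -/
def SphereWedge.incl (m : ι → ℕ) (i : ι) (y : Sphere (m i)) : SphereWedge m :=
  Collapse.mk _ ⟨i, y⟩

theorem SphereWedge.incl_base (i : ι) : incl m i (Sphere.base (m i)) = pt m :=
  Collapse.mk_eq_pt ⟨i, rfl⟩

theorem SphereWedge.continuous_incl (i : ι) : Continuous (incl m i) :=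
  Collapse.continuous_mk.comp continuous_sigmaMk

end Wedge

variable {V ι : Type*} [DecidableEq V]

/-- A division of the simplices of `K` outside `L` into the critical simplices `z i`, which are
maximal in `K` and have boundary in `L`, and simplices `σ` with a vertex `c σ` towards which they
can be contracted modulo `L`, compatibly with passing to faces. -/
structure ConeMatching (K L : PreAbstractSimplicialComplex V) (m : ι → ℕ)
    (z : ∀ i, Fin (m i + 1) ↪ V) (c : Finset V → V) : Prop where
  mem : ∀ i, vertexSet (z i) ∈ K.faces
  notMem : ∀ i, vertexSet (z i) ∉ L.faces
  inj : ∀ i j, vertexSet (z i) = vertexSet (z j) → i = j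
  maximal : ∀ i, ∀ σ ∈ K.faces, vertexSet (z i) ⊆ σ → σ = vertexSet (z i)
  boundary : ∀ i, ∀ τ ∈ K.faces, τ ⊆ vertexSet (z i) → τ ∉ L.faces → τ = vertexSet (z i)
  insert_mem : ∀ σ ∈ K.faces, σ ∉ L.faces → (∀ i, σ ≠ vertexSet (z i)) →
    insert (c σ) σ ∈ K.faces
  single_mem : ∀ σ ∈ K.faces, σ ∉ L.faces → (∀ i, σ ≠ vertexSet (z i)) → {c σ} ∈ L.faces
  cone_eq : ∀ σ ∈ K.faces, σ ∉ L.faces → (∀ i, σ ≠ vertexSet (z i)) →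
    ∀ τ ⊆ σ, τ ∈ K.faces → τ ∉ L.faces → c τ = c σ
  insert_mem_of_mem : ∀ σ ∈ K.faces, σ ∉ L.faces → (∀ i, σ ≠ vertexSet (z i)) →
    ∀ τ ⊆ σ, τ ∈ L.faces → insert (c σ) τ ∈ L.faces

/-! ### The homotopy equivalence attached to a cone matching. -/

namespace ConeMatching

variable {K L : PreAbstractSimplicialComplex V} {m : ι → ℕ} {z : ∀ i, Fin (m i + 1) ↪ V}
  {c : Finset V → V}

open Classical in
/-- The map from `|K|` to the wedge of spheres that collapses everything outside the open critical
simplices. -/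
def toWedgeAux (K : PreAbstractSimplicialComplex V) (m : ι → ℕ) (z : ∀ i, Fin (m i + 1) ↪ V)
    (p : Realization K) : SphereWedge m :=
  if h : ∃ i, p.weight.support = vertexSet (z i) then
    SphereWedge.incl m h.choose (simplexToSphere (simplexCoord (z h.choose) ⟨p, h.choose_spec.le⟩))
  else SphereWedge.pt m

/-- The formula for the open critical simplex persists on its boundary, where both sides are the
base point. The chosen index must be `i`, because one critical simplex contained in another equals
it by maximality. -/
theorem toWedgeAux_of_subset (H : ConeMatching K L m z c) (i : ι)
    (p : CoordSimplex K (vertexSet (z i))) :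
    toWedgeAux K m z p.1 = SphereWedge.incl m i (simplexToSphere (simplexCoord (z i) p)) := by
  rw [toWedgeAux]
  split_ifs with h
  · have hi : h.choose = i := by
      refine H.inj _ _ (H.maximal h.choose _ (H.mem i) ?_).symm
      rw [← h.choose_spec]
      exact p.2
    have key : ∀ j (hj : p.1.weight.support ⊆ vertexSet (z j)), j = i →
        SphereWedge.incl m j (simplexToSphere (simplexCoord (z j) ⟨p.1, hj⟩)) =
          SphereWedge.incl m i (simplexToSphere (simplexCoord (z i) p)) := by
      rintro j hj rfl; rfl
    exact key _ _ hi
  · have h' : ¬ p.1.weight.support = vertexSet (z i) := fun h' => h ⟨i, h'⟩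
    rw [support_eq_vertexSet_iff, not_not, ← simplexToSphere_eq_base_iff] at h'
    rw [h', SphereWedge.incl_base]

theorem continuous_toWedgeAux (H : ConeMatching K L m z c) :
    Continuous (toWedgeAux K m z) := by
  refine Realization.continuous_of_simplex fun σ hσ => ?_
  by_cases h : ∃ i, σ = vertexSet (z i)
  · obtain ⟨i, rfl⟩ := h
    simp only [H.toWedgeAux_of_subset]
    exact (SphereWedge.continuous_incl i).comp
      (continuous_simplexToSphere.comp continuous_simplexCoord)
  -- By maximality, a noncritical simplex has no critical face, so the map is constant on it.
  · have : (fun p : CoordSimplex K σ => toWedgeAux K m z p.1) = fun _ => SphereWedge.pt m := by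
      funext p
      rw [toWedgeAux, dif_neg]
      rintro ⟨i, hi⟩
      exact h ⟨i, H.maximal i σ hσ (hi ▸ p.2)⟩
    rw [this]
    exact continuous_const

/-- The collapse of `|K| / |L|` to the wedge of spheres. -/
def toWedge (H : ConeMatching K L m z c) : C(Collapse (subRealization K L), SphereWedge m) where
  toFun := Collapse.lift (toWedgeAux K m z) (SphereWedge.pt m) (by
    intro p hp
    rw [toWedgeAux, dif_neg]
    rintro ⟨i, hi⟩
    exact H.notMem i (hi ▸ hp))
  continuous_toFun := Collapse.continuous_lift _ H.continuous_toWedgeAux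

theorem mem_of_coord_eq_zero (H : ConeMatching K L m z c) (i : ι)
    {x : stdSimplex ℝ (Fin (m i + 1))} (h : ∃ j, x.1 j = 0) :
    simplexPoint (z i) (H.mem i) x ∈ subRealization K L := by
  by_contra hL
  have := H.boundary i _ (simplexPoint (z i) (H.mem i) x).support_mem
    (simplexPoint_support_subset _ _) hL
  exact (simplexPoint_support_eq_iff _ _).1 this h

open Classical in
/-- The inclusion of the sphere of a critical simplex into `|K| / |L|`. -/
def fromSphere (H : ConeMatching K L m z c) (i : ι) (y : Sphere (m i)) :
    Collapse (subRealization K L) :=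
  if h : ∃ x, simplexToSphere x = y then
    Collapse.mk _ (simplexPoint (z i) (H.mem i) h.choose) else Collapse.pt _

/-- The choice of preimage is harmless: it is unique over the open simplex, and boundary points all
represent the base point of `|K| / |L|`. -/
theorem fromSphere_simplexToSphere (H : ConeMatching K L m z c) (i : ι)
    (x : stdSimplex ℝ (Fin (m i + 1))) :
    H.fromSphere i (simplexToSphere x) = Collapse.mk _ (simplexPoint (z i) (H.mem i) x) := by
  have h : ∃ x', simplexToSphere x' = simplexToSphere x := ⟨x, rfl⟩
  rw [fromSphere, dif_pos h]
  by_cases hx : ∃ j, x.1 j = 0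
  · rw [Collapse.mk_eq_pt (H.mem_of_coord_eq_zero i hx), Collapse.mk_eq_pt]
    apply H.mem_of_coord_eq_zero
    rwa [← simplexToSphere_eq_base_iff, h.choose_spec, simplexToSphere_eq_base_iff]
  · have hx' : h.choose = x :=
      (simplexToSphere_injOn (fun j hj => hx ⟨j, hj⟩) h.choose_spec.symm).symm
    rw [hx']

theorem fromSphere_base (H : ConeMatching K L m z c) (i : ι) :
    H.fromSphere i (Sphere.base (m i)) = Collapse.pt _ := by
  rw [fromSphere]
  split_ifs with h
  · exact Collapse.mk_eq_pt (H.mem_of_coord_eq_zero i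
      ((simplexToSphere_eq_base_iff _).1 h.choose_spec))
  · rfl

theorem continuous_fromSphere (H : ConeMatching K L m z c) (i : ι) :
    Continuous (H.fromSphere i) := by
  rw [isQuotientMap_simplexToSphere.continuous_iff]
  have h0 : (H.fromSphere i ∘ Sum.elim simplexToSphere fun _ : Unit => Sphere.base (m i)) ∘
      Sum.inr =
      fun _ => Collapse.pt (subRealization K L) := funext fun _ => H.fromSphere_base i
  have h1 : (H.fromSphere i ∘ Sum.elim simplexToSphere fun _ : Unit => Sphere.base (m i)) ∘
      Sum.inl =
      fun x => Collapse.mk (subRealization K L) (simplexPoint (z i) (H.mem i) x) :=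
    funext fun x => H.fromSphere_simplexToSphere i x
  rw [continuous_sum_dom, h0, h1]
  exact ⟨Collapse.continuous_mk.comp (continuous_simplexPoint (H.mem i)), continuous_const⟩

/-- The inclusion of the wedge of the spheres of the critical simplices into `|K| / |L|`. -/
def fromWedge (H : ConeMatching K L m z c) : C(SphereWedge m, Collapse (subRealization K L)) where
  toFun := Collapse.lift (fun y => H.fromSphere y.1 y.2) (Collapse.pt _) (by
    rintro _ ⟨i, rfl⟩
    exact H.fromSphere_base i)
  continuous_toFun := Collapse.continuous_lift _ (continuous_sigma H.continuous_fromSphere)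

theorem toWedge_fromSphere (H : ConeMatching K L m z c) (i : ι) (y : Sphere (m i)) :
    H.toWedge (H.fromSphere i y) = SphereWedge.incl m i y := by
  by_cases hy : y = Sphere.base (m i)
  · rw [hy, H.fromSphere_base, SphereWedge.incl_base]; rfl
  · obtain ⟨x, rfl⟩ := exists_simplexToSphere_eq hy
    rw [H.fromSphere_simplexToSphere]
    refine (H.toWedgeAux_of_subset i ⟨_, simplexPoint_support_subset (H.mem i) x⟩).trans ?_
    rw [simplexCoord_simplexPoint]

theorem toWedge_comp_fromWedge (H : ConeMatching K L m z c) :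
    H.toWedge.comp H.fromWedge = ContinuousMap.id _ := by
  ext1 x
  revert x
  refine Collapse.ind (fun y => ?_) rfl
  exact H.toWedge_fromSphere y.1 y.2

open Classical in
/-- The contraction of the noncritical simplices. -/
def deformAux (K L : PreAbstractSimplicialComplex V) (z : ∀ i, Fin (m i + 1) ↪ V)
    (c : Finset V → V) (p : Realization K) (s : unitInterval) : Collapse (subRealization K L) :=
  if p.weight.support ∈ L.faces then Collapse.pt _
  else if ∃ i, p.weight.support = vertexSet (z i) then Collapse.mk _ p
  else if h : insert (c p.weight.support) p.weight.support ∈ K.faces then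
    Collapse.mk _ (p.join _ h s)
  else Collapse.pt _

theorem deformAux_of_mem {p : Realization K} (hp : p ∈ subRealization K L) (s : unitInterval) :
    deformAux K L z c p s = Collapse.pt _ :=
  if_pos hp

theorem deformAux_critical (H : ConeMatching K L m z c) {i : ι} {p : Realization K}
    (hp : p.weight.support ⊆ vertexSet (z i)) (s : unitInterval) :
    deformAux K L z c p s = Collapse.mk _ p := by
  rw [deformAux]
  split_ifs with h h1 h2
  · exact (Collapse.mk_eq_pt (A := subRealization K L) h).symm
  · rfl
  all_goals exact (h1 ⟨i, H.boundary i _ p.support_mem hp h⟩).elim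

theorem insert_support_mem (H : ConeMatching K L m z c) {σ : Finset V} (hσ : σ ∈ K.faces)
    (hL : σ ∉ L.faces) (hc : ∀ i, σ ≠ vertexSet (z i)) {p : Realization K}
    (hp : p.weight.support ⊆ σ) : insert (c σ) p.weight.support ∈ K.faces :=
  face_mono (H.insert_mem σ hσ hL hc) (Finset.insert_subset_insert _ hp)
    (Finset.insert_nonempty _ _)

/-- A single formula covers the whole closed simplex `σ`, which gives continuity. Its faces outside
`L` share the cone vertex `c σ` and are not critical; its faces in `L` stay in `L` when `c σ` is
added, so there both sides are the base point. -/
theorem deformAux_noncritical (H : ConeMatching K L m z c) {σ : Finset V} (hσ : σ ∈ K.faces)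
    (hL : σ ∉ L.faces) (hc : ∀ i, σ ≠ vertexSet (z i)) {p : Realization K}
    (hp : p.weight.support ⊆ σ) (s : unitInterval) :
    deformAux K L z c p s =
      Collapse.mk _ (p.join (c σ) (H.insert_support_mem hσ hL hc hp) s) := by
  have hj := H.insert_support_mem hσ hL hc hp
  rw [deformAux]
  by_cases h : p.weight.support ∈ L.faces
  · rw [if_pos h, Collapse.mk_eq_pt]
    refine face_mono (H.insert_mem_of_mem σ hσ hL hc _ hp h) (join_support_subset _ _ _) ?_
    exact face_nonempty (p.join (c σ) hj s).support_mem
  · have h1 : ¬ ∃ i, p.weight.support = vertexSet (z i) := by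
      rintro ⟨i, hi⟩
      exact hc i (H.maximal i σ hσ (hi ▸ hp))
    have h2 := H.cone_eq σ hσ hL hc _ hp p.support_mem h
    rw [if_neg h, if_neg h1]
    rw [dif_pos (by rwa [h2])]
    congr 1
    exact p.join_congr h2 _ _ _

theorem continuous_deformAux_simplex (H : ConeMatching K L m z c) {σ : Finset V}
    (hσ : σ ∈ K.faces) :
    Continuous fun q : CoordSimplex K σ × unitInterval => deformAux K L z c q.1.1 q.2 := by
  by_cases hL : σ ∈ L.faces
  · have : (fun q : CoordSimplex K σ × unitInterval => deformAux K L z c q.1.1 q.2) =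
        fun _ => Collapse.pt _ :=
      funext fun q => deformAux_of_mem (face_mono hL q.1.2 (face_nonempty q.1.1.support_mem)) _
    rw [this]
    exact continuous_const
  by_cases hc : ∃ i, σ = vertexSet (z i)
  · obtain ⟨i, rfl⟩ := hc
    simp only [fun q : CoordSimplex K (vertexSet (z i)) × unitInterval =>
      H.deformAux_critical q.1.2 q.2]
    exact Collapse.continuous_mk.comp ((CoordSimplex.continuous_val hσ).comp continuous_fst)
  · push Not at hc
    simp only [fun q : CoordSimplex K σ × unitInterval =>
      H.deformAux_noncritical hσ hL hc q.1.2 q.2]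
    refine Collapse.continuous_mk.comp ?_
    refine Realization.continuous_of_weight (H.insert_mem σ hσ hL hc)
      (fun q => (join_support_subset _ _ _).trans (Finset.insert_subset_insert _ q.1.2))
      fun v => ?_
    simp only [Realization.join, Finsupp.add_apply, Finsupp.smul_apply, smul_eq_mul,
      Finsupp.single_apply]
    have h1 : Continuous fun q : CoordSimplex K σ × unitInterval => q.1.1.weight v :=
      (CoordSimplex.continuous_weight σ v).comp continuous_fst
    split_ifs <;> fun_prop

theorem continuous_deformAux_left (H : ConeMatching K L m z c) (p : Realization K) :
    Continuous (deformAux K L z c p) :=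
  let q : CoordSimplex K p.weight.support := ⟨p, subset_rfl (a := p.weight.support)⟩
  (H.continuous_deformAux_simplex p.support_mem).comp (Continuous.prodMk_right q)

/-- The contraction of the noncritical simplices, as a map to the path space. -/
def deformPath (H : ConeMatching K L m z c) :
    C(Collapse (subRealization K L), C(unitInterval, Collapse (subRealization K L))) where
  toFun := Collapse.lift (fun p => ⟨deformAux K L z c p, H.continuous_deformAux_left p⟩)
    (ContinuousMap.const _ (Collapse.pt _)) (by
      intro p hp
      ext1 s
      exact deformAux_of_mem hp s)
  continuous_toFun := by
    -- With values in the path space, continuity can be tested on closed simplices, without knowing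
    -- that the product of the quotient map with the interval is a quotient map.
    refine Collapse.continuous_lift _ (Realization.continuous_of_simplex fun σ hσ => ?_)
    exact (ContinuousMap.curry ⟨_, H.continuous_deformAux_simplex hσ⟩).continuous

/-- The deformation of `|K| / |L|` onto the wedge of the spheres of the critical simplices. -/
def deform (H : ConeMatching K L m z c) :
    (ContinuousMap.id (Collapse (subRealization K L))).Homotopy
      (H.fromWedge.comp H.toWedge) where
  toFun q := H.deformPath q.2 q.1
  continuous_toFun :=
    (ContinuousMap.continuous_uncurry_of_continuous H.deformPath).comp continuous_swap
  map_zero_left := by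
    refine Collapse.ind (fun p => ?_) rfl
    change deformAux K L z c p 0 = Collapse.mk _ p
    by_cases hL : p.weight.support ∈ L.faces
    · rw [deformAux_of_mem hL, Collapse.mk_eq_pt (A := subRealization K L) hL]
    by_cases hc : ∃ i, p.weight.support = vertexSet (z i)
    · obtain ⟨i, hi⟩ := hc
      exact H.deformAux_critical hi.le 0
    · push Not at hc
      rw [H.deformAux_noncritical p.support_mem hL hc subset_rfl, Realization.join_zero]
  map_one_left := by
    refine Collapse.ind (fun p => ?_) rfl
    change deformAux K L z c p 1 = H.fromWedge (toWedgeAux K m z p)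
    by_cases hc : ∃ i, p.weight.support = vertexSet (z i)
    · obtain ⟨i, hi⟩ := hc
      rw [H.deformAux_critical hi.le 1]
      rw [show toWedgeAux K m z p = _ from H.toWedgeAux_of_subset i ⟨p, hi.le⟩]
      refine Eq.trans ?_ (H.fromSphere_simplexToSphere i _).symm
      exact congrArg _ (simplexPoint_simplexCoord (H.mem i) ⟨p, hi.le⟩).symm
    rw [toWedgeAux, dif_neg hc]
    change _ = Collapse.pt _
    by_cases hL : p.weight.support ∈ L.faces
    · exact deformAux_of_mem hL 1
    · push Not at hc
      rw [H.deformAux_noncritical p.support_mem hL hc subset_rfl, Collapse.mk_eq_pt]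
      -- At time `1` the point has reached the cone vertex, which is a simplex of `L`.
      change (Realization.join _ _ _ _).weight.support ∈ L.faces
      rw [Realization.join_one_weight, Finsupp.support_single _ one_ne_zero]
      exact H.single_mem _ p.support_mem hL hc

/-- `|K| / |L|` is homotopy equivalent to the wedge of the spheres of the critical simplices. -/
def homotopyEquiv (H : ConeMatching K L m z c) :
    ContinuousMap.HomotopyEquiv (Collapse (subRealization K L)) (SphereWedge m) where
  toFun := H.toWedge
  invFun := H.fromWedge
  left_inv := ⟨H.deform.symm⟩
  right_inv := by rw [H.toWedge_comp_fromWedge]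

end ConeMatching

/-! ### Frames of chains -/

section Chains

variable {P : Type*} [PartialOrder P] {σ τ : Finset P}

theorem exists_greatest_of_isChain (hσ : IsChain (· ≤ ·) (σ : Set P)) {q : P → Prop}
    (h : ∃ x ∈ σ, q x) : ∃ x ∈ σ, q x ∧ ∀ y ∈ σ, q y → y ≤ x := by
  classical
  obtain ⟨x, hx⟩ := (σ.filter q).exists_maximal (by
    obtain ⟨x, hx, hqx⟩ := h
    exact ⟨x, Finset.mem_filter.2 ⟨hx, hqx⟩⟩)
  obtain ⟨hxσ, hqx⟩ := Finset.mem_filter.1 hx.1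
  refine ⟨x, hxσ, hqx, fun y hy hqy => ?_⟩
  rcases hσ.total hxσ hy with h | h
  · exact hx.2 (Finset.mem_filter.2 ⟨hy, hqy⟩) h
  · exact h

theorem exists_least_of_isChain (hσ : IsChain (· ≤ ·) (σ : Set P)) {q : P → Prop}
    (h : ∃ x ∈ σ, q x) : ∃ x ∈ σ, q x ∧ ∀ y ∈ σ, q y → x ≤ y :=
  exists_greatest_of_isChain (P := Pᵒᵈ) hσ.symm h

/-- The properties of the relation `d(x, x') = t' - t` on a causal poset on which the
decomposition of chains along their frames depends. -/
structure IsNullRel (N : P → P → Prop) : Prop where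
  left : ∀ {u v w}, u ≤ v → v ≤ w → N u w → N u v
  right : ∀ {u v w}, u ≤ v → v ≤ w → N u w → N v w
  glue : ∀ {u v w z}, u < v → v < w → w < z → N u w → N v z → N u z
  total : ∀ {u v w p}, u < p → p < w → u < v → v < w → N u w → p ≤ v ∨ v ≤ p

/-- A chain that runs from a minimal to a maximal element by steps in `N`. -/
structure IsFull (N : P → P → Prop) (σ : Finset P) : Prop where
  chain : IsChain (· ≤ ·) (σ : Set P)
  exists_isMin : ∃ u ∈ σ, IsMin u
  exists_isMax : ∃ u ∈ σ, IsMax u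
  step : ∀ u ∈ σ, ∀ w ∈ σ, u < w → (∀ v ∈ σ, u < v → ¬ v < w) → N u w

/-- A singular point of a chain. -/
def IsSingularIn (N : P → P → Prop) (σ : Finset P) (v : P) : Prop :=
  v ∈ σ ∧ ∀ u ∈ σ, ∀ w ∈ σ, u < v → v < w → ¬ N u w

open Classical in
/-- The frame of a chain, which consists of its singular points. -/
def frame (N : P → P → Prop) (σ : Finset P) : Finset P := σ.filter (IsSingularIn N σ)

/-- The points in the gaps of a frame. -/
def IsGap (N : P → P → Prop) (F : Finset P) (p : P) : Prop :=
  ∃ u ∈ F, ∃ w ∈ F, u < p ∧ p < w ∧ N u w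

variable {N : P → P → Prop}

theorem mem_frame {v : P} : v ∈ frame N σ ↔ IsSingularIn N σ v := by
  simp only [frame, Finset.mem_filter, and_iff_right_iff_imp]
  exact fun h => h.1

theorem frame_subset : frame N σ ⊆ σ := fun _ hv => (mem_frame.1 hv).1

namespace IsFull

theorem exists_le (hσ : IsFull N σ) (hτ : IsChain (· ≤ ·) (τ : Set P)) (h : σ ⊆ τ) {v : P}
    (hv : v ∈ τ) : ∃ u ∈ σ, u ≤ v := by
  obtain ⟨u, hu, hmin⟩ := hσ.exists_isMin
  refine ⟨u, hu, ?_⟩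
  rcases hτ.total (h hu) hv with h' | h'
  exacts [h', hmin h']

theorem exists_ge (hσ : IsFull N σ) (hτ : IsChain (· ≤ ·) (τ : Set P)) (h : σ ⊆ τ) {v : P}
    (hv : v ∈ τ) : ∃ u ∈ σ, v ≤ u := by
  obtain ⟨u, hu, hmax⟩ := hσ.exists_isMax
  refine ⟨u, hu, ?_⟩
  rcases hτ.total hv (h hu) with h' | h'
  exacts [h', hmax h']

/-- Two consecutive points of `τ` lie within one step of `σ`, and `N` passes to subintervals. -/
theorem of_subset (hN : IsNullRel N) (hσ : IsFull N σ) (hτ : IsChain (· ≤ ·) (τ : Set P))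
    (h : σ ⊆ τ) : IsFull N τ := by
  refine ⟨hτ, ?_, ?_, fun u hu w hw huw hcons => ?_⟩
  · obtain ⟨x, hx, hx'⟩ := hσ.exists_isMin
    exact ⟨x, h hx, hx'⟩
  · obtain ⟨x, hx, hx'⟩ := hσ.exists_isMax
    exact ⟨x, h hx, hx'⟩
  obtain ⟨u', hu', hle, hgr⟩ := exists_greatest_of_isChain hσ.chain (hσ.exists_le hτ h hu)
  obtain ⟨w', hw', hge, hlt⟩ := exists_least_of_isChain hσ.chain (hσ.exists_ge hτ h hw)
  have key : N u' w' := by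
    refine hσ.step u' hu' w' hw' (hle.trans_lt (huw.trans_le hge)) fun x hx h1 h2 => ?_
    rcases hτ.total (h hx) hu with h3 | h3
    · exact (hgr x hx h3).not_gt h1
    rcases hτ.total hw (h hx) with h4 | h4
    · exact (hlt x hx h4).not_gt h2
    refine hcons x (h hx) (lt_of_le_of_ne h3 ?_) (lt_of_le_of_ne h4 ?_)
    · rintro rfl
      exact (hgr u hx le_rfl).not_gt h1
    · rintro rfl
      exact (hlt x hx le_rfl).not_gt h2
  exact hN.right hle huw.le (hN.left (hle.trans huw.le) hge key)

/-- A point outside `σ` of a larger chain lies between two members of `σ` related by `N`. -/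
theorem exists_between (hσ : IsFull N σ) (hτ : IsChain (· ≤ ·) (τ : Set P)) (h : σ ⊆ τ) {v : P}
    (hv : v ∈ τ) (hvσ : v ∉ σ) : ∃ u ∈ σ, ∃ w ∈ σ, u < v ∧ v < w ∧ N u w := by
  obtain ⟨u, hu, hle, hgr⟩ := exists_greatest_of_isChain hσ.chain (hσ.exists_le hτ h hv)
  obtain ⟨w, hw, hge, hlt⟩ := exists_least_of_isChain hσ.chain (hσ.exists_ge hτ h hv)
  have huv : u < v := lt_of_le_of_ne hle (by rintro rfl; exact hvσ hu)
  have hvw : v < w := lt_of_le_of_ne hge (by rintro rfl; exact hvσ hw)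
  refine ⟨u, hu, w, hw, huv, hvw, hσ.step u hu w hw (huv.trans hvw) fun x hx h1 h2 => ?_⟩
  rcases hτ.total (h hx) hv with h3 | h3
  · exact (hgr x hx h3).not_gt h1
  · exact (hlt x hx h3).not_gt h2

/-- Around a smooth point of `τ`, the relation `N` extends across the point. -/
theorem null_of_smooth (hN : IsNullRel N) (hτ : IsChain (· ≤ ·) (τ : Set P)) {u v w x y : P}
    (hu : u ∈ τ) (hw : w ∈ τ) (hx : x ∈ τ) (hy : y ∈ τ) (huv : u < v) (hvw : v < w)
    (hxv : x < v) (hvy : v < y) (hNuw : N u w) (hNxv : N x v) (hNvy : N v y) : N x y := by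
  -- The left end of the pair `u, w` is moved to `x`: by restriction if `u ≤ x`, otherwise by gluing
  -- `N x v` and `N u w` along their overlap. The right end is then moved to `y` in the same way.
  have h1 : N x w := by
    rcases hτ.total hu hx with h | h
    · exact hN.right h (hxv.trans hvw).le hNuw
    rcases h.eq_or_lt with rfl | h
    · exact hNuw
    · exact hN.glue h huv hvw hNxv hNuw
  rcases hτ.total hy hw with h | h
  · exact hN.left (hxv.trans hvy).le h h1
  rcases h.eq_or_lt with rfl | h
  · exact h1
  · exact hN.glue hxv hvw h h1 hNvy

/-- If a pair of `τ` straddling `v` is in `N`, then by `null_of_smooth` so is the pair of neighbours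
of `v` in `σ`. Conversely, a point of `τ` outside `σ` lies inside a step of `σ` and is smooth. -/
theorem isSingularIn_iff (hN : IsNullRel N) (hσ : IsFull N σ) (hτ : IsChain (· ≤ ·) (τ : Set P))
    (h : σ ⊆ τ) (v : P) : IsSingularIn N σ v ↔ IsSingularIn N τ v := by
  constructor
  · rintro ⟨hv, hs⟩
    refine ⟨h hv, fun u hu w hw huv hvw hNuw => ?_⟩
    obtain ⟨b, hb, hbu⟩ := hσ.exists_le hτ h hu
    obtain ⟨t, ht, hwt⟩ := hσ.exists_ge hτ h hw
    obtain ⟨x, hx, hxv, hgr⟩ := exists_greatest_of_isChain hσ.chain (q := fun x => x < v)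
      ⟨b, hb, hbu.trans_lt huv⟩
    obtain ⟨y, hy, hvy, hlt⟩ := exists_least_of_isChain hσ.chain (q := fun x => v < x)
      ⟨t, ht, hvw.trans_le hwt⟩
    refine hs x hx y hy hxv hvy
      (null_of_smooth hN hτ hu hw (h hx) (h hy) huv hvw hxv hvy hNuw ?_ ?_)
    · exact hσ.step x hx v hv hxv fun a ha h1 h2 => (hgr a ha h2).not_gt h1
    · exact hσ.step v hv y hy hvy fun a ha h1 h2 => (hlt a ha h1).not_gt h2
  · rintro ⟨hv, hs⟩
    refine ⟨?_, fun u hu w hw => hs u (h hu) w (h hw)⟩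
    by_contra hvσ
    obtain ⟨u, hu, w, hw, huv, hvw, hNuw⟩ := hσ.exists_between hτ h hv hvσ
    exact hs u (h hu) w (h hw) huv hvw hNuw

theorem frame_eq (hN : IsNullRel N) (hσ : IsFull N σ) (hτ : IsChain (· ≤ ·) (τ : Set P))
    (h : σ ⊆ τ) : frame N σ = frame N τ :=
  Finset.ext fun v => by rw [mem_frame, mem_frame, hσ.isSingularIn_iff hN hτ h]

/-- The only new step joins the two neighbours of `v`, and `null_of_smooth` puts it in `N`. The
extremal points are never lost, since no pair straddles them. -/
theorem erase [DecidableEq P] (hN : IsNullRel N) (hσ : IsFull N σ) {v : P} (hv : v ∈ σ)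
    (hs : ¬ IsSingularIn N σ v) : IsFull N (σ.erase v) := by
  obtain ⟨u, hu, w, hw, huv, hvw, hNuw⟩ : ∃ u ∈ σ, ∃ w ∈ σ, u < v ∧ v < w ∧ N u w := by
    by_contra! h
    exact hs ⟨hv, fun u hu w hw h1 h2 => h u hu w hw h1 h2⟩
  have hch : IsChain (· ≤ ·) ((σ.erase v : Finset P) : Set P) :=
    hσ.chain.mono (Finset.coe_subset.2 (Finset.erase_subset _ _))
  refine ⟨hch, ?_, ?_, fun x hx y hy hxy hcons => ?_⟩
  · obtain ⟨b, hb, hmin⟩ := hσ.exists_isMin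
    refine ⟨b, Finset.mem_erase.2 ⟨?_, hb⟩, hmin⟩
    rintro rfl
    exact hmin.not_lt huv
  · obtain ⟨b, hb, hmax⟩ := hσ.exists_isMax
    refine ⟨b, Finset.mem_erase.2 ⟨?_, hb⟩, hmax⟩
    rintro rfl
    exact hmax.not_lt hvw
  obtain ⟨hxv, hx⟩ := Finset.mem_erase.1 hx
  obtain ⟨hyv, hy⟩ := Finset.mem_erase.1 hy
  by_cases h : x < v ∧ v < y
  · refine null_of_smooth hN hσ.chain hu hw hx hy huv hvw h.1 h.2 hNuw ?_ ?_
    · exact hσ.step x hx v hv h.1 fun a ha h1 h2 =>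
        hcons a (Finset.mem_erase.2 ⟨h2.ne, ha⟩) h1 (h2.trans h.2)
    · exact hσ.step v hv y hy h.2 fun a ha h1 h2 =>
        hcons a (Finset.mem_erase.2 ⟨h1.ne', ha⟩) (h.1.trans h1) h2
  · refine hσ.step x hx y hy hxy fun a ha h1 h2 => ?_
    by_cases hav : a = v
    · subst hav; exact h ⟨h1, h2⟩
    · exact hcons a (Finset.mem_erase.2 ⟨hav, ha⟩) h1 h2

/-- Smooth points are deleted one at a time; the frame does not change, so the process ends at the
frame. -/
theorem frame_isFull (hN : IsNullRel N) (hσ : IsFull N σ) : IsFull N (frame N σ) := by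
  classical
  induction hn : σ.card using Nat.strong_induction_on generalizing σ with
  | _ n ih =>
    by_cases h : ∀ v ∈ σ, IsSingularIn N σ v
    · have : frame N σ = σ :=
        Finset.Subset.antisymm frame_subset fun v hv => mem_frame.2 (h v hv)
      rwa [this]
    · push Not at h
      obtain ⟨v, hv, hs⟩ := h
      have he := hσ.erase hN hv hs
      rw [← he.frame_eq hN hσ.chain (Finset.erase_subset _ _)]
      exact ih _ (hn ▸ Finset.card_erase_lt_of_mem hv) he rfl

theorem insert_gap [DecidableEq P] (hN : IsNullRel N) (hσ : IsFull N σ) {p : P} (hp : IsGap N (frame N σ) p) :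
    IsFull N (insert p σ) := by
  refine hσ.of_subset hN ?_ (Finset.subset_insert _ _)
  obtain ⟨u, hu, w, hw, hup, hpw, hNuw⟩ := hp
  rw [Finset.coe_insert]
  refine hσ.chain.insert fun v hv _ => ?_
  rcases hσ.chain.total hv (frame_subset hu) with h | h
  · exact Or.inr (h.trans hup.le)
  rcases hσ.chain.total (frame_subset hw) hv with h' | h'
  · exact Or.inl (hpw.le.trans h')
  rcases h.eq_or_lt with rfl | h
  · exact Or.inr hup.le
  rcases h'.eq_or_lt with rfl | h'
  · exact Or.inl hpw.le
  -- Only points strictly between `u` and `w` could fail to be comparable with `p`.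
  exact hN.total hup hpw h h' hNuw

theorem not_mem_frame_of_isGap {p : P} (hp : IsGap N (frame N σ) p) : p ∉ frame N σ := by
  obtain ⟨u, hu, w, hw, hup, hpw, hNuw⟩ := hp
  exact fun h => (mem_frame.1 h).2 u (frame_subset hu) w (frame_subset hw) hup hpw hNuw

/-- The chains `insert p τ` and `σ` have the same frame, both being contained in `insert p σ`. Hence
`p` is smooth in `insert p τ` and can be deleted. Contrapositively, adding the cone vertex to a
short face keeps it short. -/
theorem of_insert_gap [DecidableEq P] (hN : IsNullRel N) (hσ : IsFull N σ) {p : P}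
    (hp : IsGap N (frame N σ) p) (h : τ ⊆ σ) (hτ : IsFull N (insert p τ)) : IsFull N τ := by
  by_cases hpτ : p ∈ τ
  · rwa [Finset.insert_eq_of_mem hpτ] at hτ
  have hi := hσ.insert_gap hN hp
  have hfr : frame N (insert p τ) = frame N σ := by
    rw [hτ.frame_eq hN hi.chain (Finset.insert_subset_insert _ h),
      hσ.frame_eq hN hi.chain (Finset.subset_insert _ _)]
  have := hτ.erase hN (Finset.mem_insert_self p τ) fun hs =>
    not_mem_frame_of_isGap hp (hfr ▸ mem_frame.2 hs)
  rwa [Finset.erase_insert hpτ] at this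

end IsFull

/-- A full chain all of whose points are singular and which has no gaps. -/
structure IsCritical (N : P → P → Prop) (F : Finset P) : Prop where
  full : IsFull N F
  singular : ∀ v ∈ F, IsSingularIn N F v
  no_gap : ∀ p, ¬ IsGap N F p

theorem IsCritical.frame_eq_self {F : Finset P} (hF : IsCritical N F) : frame N F = F :=
  Finset.Subset.antisymm frame_subset fun v hv => mem_frame.2 (hF.singular v hv)

/-- The frame is itself full, so a smooth point of `σ` would lie inside one of its steps and be a
gap point. -/
theorem IsFull.isCritical (hN : IsNullRel N) (hσ : IsFull N σ)
    (h : ∀ p, ¬ IsGap N (frame N σ) p) : IsCritical N σ := by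
  have hs : frame N σ = σ := by
    refine Finset.Subset.antisymm frame_subset fun v hv => ?_
    by_contra hvF
    exact h v ((hσ.frame_isFull hN).exists_between hσ.chain frame_subset hv hvF)
  exact ⟨hσ, fun v hv => mem_frame.1 (hs.symm ▸ hv), fun p => hs ▸ h p⟩

theorem IsCritical.eq_of_superset (hN : IsNullRel N) {F : Finset P} (hF : IsCritical N F)
    (hσ : IsChain (· ≤ ·) (σ : Set P)) (h : F ⊆ σ) : σ = F := by
  have hfr : frame N σ = F := by rw [← hF.full.frame_eq hN hσ h, hF.frame_eq_self]
  have := (hF.full.of_subset hN hσ h).isCritical hN (by rw [hfr]; exact hF.no_gap)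
  rw [← this.frame_eq_self, hfr]

theorem IsCritical.eq_of_subset (hN : IsNullRel N) {F : Finset P} (hF : IsCritical N F)
    (hτ : IsFull N τ) (h : τ ⊆ F) : τ = F := by
  refine Finset.Subset.antisymm h ?_
  rw [← hF.frame_eq_self, ← hτ.frame_eq hN hF.full.chain h]
  exact frame_subset

/-- A point in a gap of the frame of a chain, if there is one. -/
def gapPoint [Nonempty P] (N : P → P → Prop) (σ : Finset P) : P :=
  Classical.epsilon fun p => IsGap N (frame N σ) p

theorem coneMatching_of_isNullRel [DecidableEq P] [Nonempty P] (hN : IsNullRel N)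
    {L : PreAbstractSimplicialComplex P}
    (hL : ∀ σ ∈ (orderComplex P).faces, σ ∉ L.faces ↔ IsFull N σ)
    {ι : Type*} {m : ι → ℕ} {z : ∀ i, Fin (m i + 1) ↪ P}
    (hz : ∀ i, IsCritical N (vertexSet (z i)))
    (hinj : ∀ i j, vertexSet (z i) = vertexSet (z j) → i = j)
    (hsurj : ∀ F, IsCritical N F → ∃ i, F = vertexSet (z i)) :
    ConeMatching (orderComplex P) L m z (gapPoint N) := by
  have hmem : ∀ σ, IsFull N σ → σ ∈ (orderComplex P).faces := fun σ hσ =>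
    ⟨hσ.exists_isMin.imp fun _ h => h.1, hσ.chain⟩
  have hgap : ∀ σ ∈ (orderComplex P).faces, σ ∉ L.faces → (∀ i, σ ≠ vertexSet (z i)) →
      IsGap N (frame N σ) (gapPoint N σ) := by
    intro σ hσ hσL hc
    refine Classical.epsilon_spec (p := fun p => IsGap N (frame N σ) p) ?_
    by_contra! h
    obtain ⟨i, hi⟩ := hsurj σ (((hL σ hσ).1 hσL).isCritical hN h)
    exact hc i hi
  constructor
  · exact fun i => hmem _ (hz i).full
  · exact fun i => (hL _ (hmem _ (hz i).full)).2 (hz i).full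
  · exact hinj
  · exact fun i σ hσ h => (hz i).eq_of_superset hN hσ.2 h
  · exact fun i τ hτ h hτL => (hz i).eq_of_subset hN ((hL τ hτ).1 hτL) h
  · exact fun σ hσ hσL hc => hmem _ (((hL σ hσ).1 hσL).insert_gap hN (hgap σ hσ hσL hc))
  -- A gap point lies strictly above another point, so it is not minimal and its singleton is not
  -- full.
  · intro σ hσ hσL hc
    obtain ⟨u, -, w, -, hup, -⟩ := hgap σ hσ hσL hc
    by_contra h
    obtain ⟨b, hb, hmin⟩ := ((hL _ ⟨Finset.singleton_nonempty _, by simp⟩).1 h).exists_isMin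
    rw [Finset.mem_singleton.1 hb] at hmin
    exact hmin.not_lt hup
  -- `gapPoint` depends on a chain only through its frame, so equal frames give the same choice.
  · intro σ hσ hσL hc τ hτσ hτ hτL
    rw [gapPoint, gapPoint, ((hL τ hτ).1 hτL).frame_eq hN hσ.2 hτσ]
  · intro σ hσ hσL hc τ hτσ hτL
    have hfull := (hL σ hσ).1 hσL
    have hg := hgap σ hσ hσL hc
    have hτ : τ.Nonempty := face_nonempty hτL
    by_contra h
    have hi : insert (gapPoint N σ) τ ∈ (orderComplex P).faces :=
      face_mono (hmem _ (hfull.insert_gap hN hg)) (Finset.insert_subset_insert _ hτσ)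
        (Finset.insert_nonempty _ _)
    exact (hL τ (face_mono hσ hτσ hτ)).2
      (hfull.of_insert_gap hN hg hτσ ((hL _ hi).1 h)) hτL

end Chains

/-! ### Chains in the total causal poset -/

theorem exists_strictMono_of_isChain {P : Type*} [PartialOrder P] {σ : Finset P}
    (hσ : IsChain (· ≤ ·) (σ : Set P)) (h : σ.Nonempty) :
    ∃ (n : ℕ) (z : Fin (n + 1) → P), StrictMono z ∧ (σ : Set P) = Set.range z := by
  classical
  obtain ⟨n, hn⟩ : ∃ n, Fintype.card σ = n + 1 := by
    rw [Fintype.card_coe]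
    exact Nat.exists_eq_succ_of_ne_zero (Finset.card_pos.2 h).ne'
  let _ : LinearOrder σ :=
    { (inferInstance : PartialOrder σ) with
      le_total := fun a b => hσ.total a.2 b.2
      toDecidableLE := Classical.decRel _ }
  let e := Fintype.orderIsoFinOfCardEq σ hn
  refine ⟨n, fun i => (e i).1, fun i j hij => e.strictMono hij, ?_⟩
  ext v
  constructor
  · intro hv
    exact ⟨e.symm ⟨v, hv⟩, by simp⟩
  · rintro ⟨i, rfl⟩
    exact (e i).2

theorem sum_fin_succ_sub_castSucc {n : ℕ} (f : Fin (n + 1) → ℝ) :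
    ∑ i : Fin n, (f i.succ - f i.castSucc) = f (Fin.last n) - f 0 := by
  rw [Finset.sum_sub_distrib]
  have h1 := Fin.sum_univ_succ f
  have h2 := Fin.sum_univ_castSucc f
  linarith

section TotalCausal

variable {X : Type*} [MetricSpace X] {ℓ : ℝ}

namespace TotalCausal

/-- The point of `X` under a point of the total causal poset. -/
def point (u : TotalCausal X ℓ) : X := u.2.1.point

/-- The time of a point of the total causal poset. -/
def time (u : TotalCausal X ℓ) : ℝ := u.2.1.time

/-- The distance is equal to the difference in time. -/
def Null (u w : TotalCausal X ℓ) : Prop := dist u.point w.point = w.time - u.time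

theorem le_iff {u w : TotalCausal X ℓ} :
    u ≤ w ↔ u.1 = w.1 ∧ dist u.point w.point ≤ w.time - u.time := by
  obtain ⟨p, u⟩ := u
  obtain ⟨q, w⟩ := w
  constructor
  · rintro ⟨_, _, _, h⟩
    exact ⟨rfl, h⟩
  · rintro ⟨h, h'⟩
    obtain rfl : p = q := h
    exact Sigma.LE.fiber _ _ _ h'

theorem ext' {u w : TotalCausal X ℓ} (h : u.1 = w.1) (hp : u.point = w.point)
    (ht : u.time = w.time) : u = w := by
  obtain ⟨p, u⟩ := u
  obtain ⟨q, w⟩ := w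
  obtain rfl : p = q := h
  have : u = w := Subtype.ext (Spacetime.ext hp ht)
  rw [this]

theorem dist_le {u w : TotalCausal X ℓ} (h : u ≤ w) :
    dist u.point w.point ≤ w.time - u.time := (le_iff.1 h).2

theorem dist_fst_le (u : TotalCausal X ℓ) : dist u.1.1 u.point ≤ u.time := by
  have : dist u.1.1 u.point ≤ u.time - 0 := u.2.2.1
  linarith

theorem dist_snd_le (u : TotalCausal X ℓ) : dist u.point u.1.2 ≤ ℓ - u.time := u.2.2.2

theorem time_nonneg (u : TotalCausal X ℓ) : 0 ≤ u.time := dist_nonneg.trans u.dist_fst_le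

theorem time_le (u : TotalCausal X ℓ) : u.time ≤ ℓ := by
  have := u.dist_snd_le
  have := dist_nonneg (x := u.point) (y := u.1.2)
  linarith

theorem point_eq_fst {u : TotalCausal X ℓ} (h : u.time = 0) : u.point = u.1.1 :=
  (dist_le_zero.1 (u.dist_fst_le.trans h.le)).symm

theorem point_eq_snd {u : TotalCausal X ℓ} (h : u.time = ℓ) : u.point = u.1.2 :=
  dist_le_zero.1 (u.dist_snd_le.trans (by linarith))

theorem isMin_iff {u : TotalCausal X ℓ} : IsMin u ↔ u.time = 0 := by
  constructor
  · intro h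
    let b : TotalCausal X ℓ := ⟨u.1, ⟨_, le_rfl, u.2.2.1.trans u.2.2.2⟩⟩
    have hb : b ≤ u := Sigma.LE.fiber _ _ _ u.2.2.1
    rw [← h.eq_of_le hb]
    rfl
  · intro h b hb
    rw [le_iff] at hb ⊢
    have h1 := b.time_nonneg
    have h2 := dist_nonneg (x := b.point) (y := u.point)
    rw [dist_comm]
    exact ⟨hb.1.symm, by linarith⟩

theorem isMax_iff {u : TotalCausal X ℓ} : IsMax u ↔ u.time = ℓ := by
  constructor
  · intro h
    let b : TotalCausal X ℓ := ⟨u.1, ⟨_, u.2.2.1.trans u.2.2.2, le_rfl⟩⟩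
    have hb : u ≤ b := Sigma.LE.fiber _ _ _ u.2.2.2
    rw [h.eq_of_le hb]
    rfl
  · intro h b hb
    rw [le_iff] at hb ⊢
    have h1 := b.time_le
    have h2 := dist_nonneg (x := u.point) (y := b.point)
    rw [dist_comm]
    exact ⟨hb.1.symm, by linarith⟩

/-- Two causal inequalities whose sum is an equality, by the triangle inequality, are both
equalities. -/
theorem Null.left {u v w : TotalCausal X ℓ} (huv : u ≤ v) (hvw : v ≤ w) (h : Null u w) :
    Null u v := by
  have h1 := dist_le huv
  have h2 := dist_le hvw
  have h3 := dist_triangle u.point v.point w.point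
  unfold Null at *
  linarith

theorem Null.right {u v w : TotalCausal X ℓ} (huv : u ≤ v) (hvw : v ≤ w) (h : Null u w) :
    Null v w := by
  have h1 := dist_le huv
  have h2 := dist_le hvw
  have h3 := dist_triangle u.point v.point w.point
  unfold Null at *
  linarith

theorem Null.point_ne {u v : TotalCausal X ℓ} (huv : u < v) (h : Null u v) :
    u.point ≠ v.point := by
  intro hp
  refine huv.ne (ext' (le_iff.1 huv.le).1 hp ?_)
  unfold Null at h
  rw [hp, dist_self] at h
  linarith

/-- If gluing failed, the four points would form a `4`-cut. For points inside a null pair, times are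
distances from its lower end up to a constant, so the order of the interval gives the causal order.
-/
theorem isNullRel_null (hcut : fourCutInf X = ⊤)
    (htot : ∀ (a b : X) (x y : IntervalPoset a b), x ≤ y ∨ y ≤ x) :
    IsNullRel (Null : TotalCausal X ℓ → TotalCausal X ℓ → Prop) where
  left := Null.left
  right := Null.right
  glue := by
    intro u v w z huv hvw hwz huw hvz
    have h1 := huw.left huv.le hvw.le
    have h2 := huw.right huv.le hvw.le
    have h3 := hvz.right hvw.le hwz.le
    by_contra hne
    have hlt : dist u.point z.point < z.time - u.time :=
      lt_of_le_of_ne (dist_le ((huv.trans hvw).trans hwz).le) hne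
    have hc : IsFourCut ![u.point, v.point, w.point, z.point] := by
      have e1 := h1.point_ne huv
      have e2 := h2.point_ne hvw
      have e3 := h3.point_ne hwz
      unfold Null at *
      refine ⟨?_, ?_, ?_, ?_⟩
      · intro i
        fin_cases i <;> simpa
      · simp [seqLength, Fin.sum_univ_succ]
        linarith
      · simp [seqLength, Fin.sum_univ_succ]
        linarith
      · simp [seqLength, Fin.sum_univ_succ]
        linarith
    have := (iInf₂_eq_top.1 hcut) _ hc
    exact EReal.coe_ne_top _ this
  total := by
    intro u v w p hup hpw huv hvw h
    have p1 := h.left hup.le hpw.le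
    have p2 := h.right hup.le hpw.le
    have v1 := h.left huv.le hvw.le
    have v2 := h.right huv.le hvw.le
    have hfib : p.1 = v.1 := (le_iff.1 hup.le).1.symm.trans (le_iff.1 huv.le).1
    unfold Null at *
    let x : IntervalPoset u.point w.point :=
      ⟨p.point, show dist _ _ + dist _ _ = dist _ _ by linarith⟩
    let y : IntervalPoset u.point w.point :=
      ⟨v.point, show dist _ _ + dist _ _ = dist _ _ by linarith⟩
    rcases htot _ _ x y with hxy | hxy
    · have : dist u.point p.point + dist p.point v.point + dist v.point w.point =
        dist u.point w.point := hxy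
      exact Or.inl (le_iff.2 ⟨hfib, by linarith⟩)
    · have : dist u.point v.point + dist v.point p.point + dist p.point w.point =
        dist u.point w.point := hxy
      exact Or.inr (le_iff.2 ⟨hfib.symm, by linarith⟩)

theorem seqLength_le {n : ℕ} {z : Fin (n + 1) → TotalCausal X ℓ} (hz : StrictMono z) :
    seqLength (fun i => (z i).point) ≤ (z (Fin.last n)).time - (z 0).time := by
  rw [← sum_fin_succ_sub_castSucc fun i => (z i).time]
  exact Finset.sum_le_sum fun i _ => dist_le (hz i.castSucc_lt_succ).le

/-- The length is at most the sum of the time steps, which telescopes to at most `ℓ`. Equality means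
that every step is null and that the end times are `0` and `ℓ`. -/
theorem isFull_iff {n : ℕ} {z : Fin (n + 1) → TotalCausal X ℓ} (hz : StrictMono z)
    {σ : Finset (TotalCausal X ℓ)} (hσ : (σ : Set (TotalCausal X ℓ)) = Set.range z) :
    IsFull Null σ ↔ seqLength (fun i => (z i).point) = ℓ := by
  have hmem : ∀ v, v ∈ σ ↔ ∃ i, z i = v := fun v => by
    rw [← Finset.mem_coe, hσ]; rfl
  have hsum := sum_fin_succ_sub_castSucc fun i => (z i).time
  have hlast := (z (Fin.last n)).time_le
  have h0 := (z 0).time_nonneg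
  constructor
  · intro h
    obtain ⟨u, hu, hmin⟩ := h.exists_isMin
    obtain ⟨i, rfl⟩ := (hmem u).1 hu
    rw [← hmin.eq_of_le (hz.monotone (Fin.zero_le i)), isMin_iff] at hmin
    obtain ⟨w, hw, hmax⟩ := h.exists_isMax
    obtain ⟨j, rfl⟩ := (hmem w).1 hw
    rw [hmax.eq_of_le (hz.monotone (Fin.le_last j)), isMax_iff] at hmax
    simp only [hmin, hmax, sub_zero] at hsum
    refine Eq.trans (Finset.sum_congr rfl fun i _ => ?_) hsum
    refine h.step _ ((hmem _).2 ⟨_, rfl⟩) _ ((hmem _).2 ⟨_, rfl⟩) (hz i.castSucc_lt_succ) ?_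
    rintro v hv h1 h2
    obtain ⟨k, rfl⟩ := (hmem v).1 hv
    rw [hz.lt_iff_lt, Fin.lt_def] at h1 h2
    simp only [Fin.val_castSucc, Fin.val_succ] at h1 h2
    omega
  · intro h
    have hle := seqLength_le hz
    have hnull : ∀ i : Fin n, Null (z i.castSucc) (z i.succ) := by
      have h1 : ∑ i : Fin n, ((z i.succ).time - (z i.castSucc).time -
          dist (z i.castSucc).point (z i.succ).point) = 0 := by
        rw [Finset.sum_sub_distrib, hsum]
        have : ∑ i : Fin n, dist (z i.castSucc).point (z i.succ).point = ℓ := h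
        linarith
      rw [Finset.sum_eq_zero_iff_of_nonneg fun i _ =>
        sub_nonneg.2 (dist_le (hz i.castSucc_lt_succ).le)] at h1
      intro i
      have := h1 i (Finset.mem_univ i)
      unfold Null
      linarith
    refine ⟨?_, ⟨z 0, (hmem _).2 ⟨_, rfl⟩, isMin_iff.2 (by linarith)⟩,
      ⟨z (Fin.last n), (hmem _).2 ⟨_, rfl⟩, isMax_iff.2 (by linarith)⟩, ?_⟩
    · rw [hσ]
      exact hz.monotone.isChain_range
    · intro u hu w hw huw hcons
      obtain ⟨i, rfl⟩ := (hmem u).1 hu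
      obtain ⟨j, rfl⟩ := (hmem w).1 hw
      rw [hz.lt_iff_lt] at huw
      have hi : (i : ℕ) < n := by omega
      have hij : j = (⟨i, hi⟩ : Fin n).succ := by
        by_contra hne
        refine hcons (z (⟨i, hi⟩ : Fin n).succ) ((hmem _).2 ⟨_, rfl⟩) (hz ?_) (hz ?_)
        · simp [Fin.lt_def]
        · rw [Fin.lt_def]
          rw [Fin.ext_iff] at hne
          simp only [Fin.val_succ] at hne ⊢
          omega
      rw [hij]
      exact hnull ⟨i, hi⟩

/-- `IsFull` refers to no enumeration of the chain, so it settles the length for all increasing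
enumerations at once. -/
theorem notMem_shortComplex_iff {σ : Finset (TotalCausal X ℓ)}
    (hσ : σ ∈ (orderComplex (TotalCausal X ℓ)).faces) :
    σ ∉ (shortComplex X ℓ).faces ↔ IsFull Null σ := by
  obtain ⟨n, z, hz, hr⟩ := exists_strictMono_of_isChain hσ.2 hσ.1
  constructor
  · intro h
    rw [isFull_iff hz hr]
    refine le_antisymm ?_ (not_lt.1 fun hlt => h ⟨n, z, hz, hr, hlt⟩)
    have h1 := seqLength_le hz
    have h2 := (z (Fin.last n)).time_le
    have h3 := (z 0).time_nonneg
    linarith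
  · rintro h ⟨k, y, hy, hry, hlt⟩
    rw [isFull_iff hy hry] at h
    exact hlt.ne h

end TotalCausal

end TotalCausal

/-! ### Thin frames and critical chains -/

section ThinFrames

variable {X : Type*} [MetricSpace X]

/-- The length of the initial segment `(x_0, …, x_i)` of a sequence. -/
def initialLength {m : ℕ} (F : Fin (m + 1) → X) (i : Fin (m + 1)) : ℝ :=
  ∑ j : Fin m, if (j : ℕ) < i then dist (F j.castSucc) (F j.succ) else 0

variable {m : ℕ} (F : Fin (m + 1) → X)

theorem initialLength_zero : initialLength F 0 = 0 := by simp [initialLength]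

theorem initialLength_last : initialLength F (Fin.last m) = seqLength F := by
  simp [initialLength, seqLength]

theorem initialLength_succ (i : Fin m) :
    initialLength F i.succ = initialLength F i.castSucc + dist (F i.castSucc) (F i.succ) := by
  have h : dist (F i.castSucc) (F i.succ) =
      ∑ j : Fin m, if j = i then dist (F j.castSucc) (F j.succ) else 0 := by simp
  rw [initialLength, initialLength, h, ← Finset.sum_add_distrib]
  refine Finset.sum_congr rfl fun j _ => ?_
  simp only [Fin.val_succ, Fin.val_castSucc, Fin.ext_iff]
  split_ifs <;> first | omega | simp

/-- The lift of a sequence to spacetime along which time is the length. -/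
def spacetimeSeq (i : Fin (m + 1)) : Spacetime X := ⟨F i, initialLength F i⟩

theorem spacetimeSeq_monotone : Monotone (spacetimeSeq F) := by
  refine Fin.monotone_iff_le_succ.2 fun i => ?_
  change dist (F i.castSucc) (F i.succ) ≤ initialLength F i.succ - initialLength F i.castSucc
  rw [initialLength_succ]
  linarith

variable {F} {ℓ : ℝ}

/-- The lift of a sequence of length `ℓ` to the total causal poset. -/
def causalSeq (F : Fin (m + 1) → X) (h : seqLength F = ℓ) (i : Fin (m + 1)) : TotalCausal X ℓ :=
  ⟨(F 0, F (Fin.last m)), ⟨spacetimeSeq F i, by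
    have h1 := spacetimeSeq_monotone F (Fin.zero_le i)
    have h2 := spacetimeSeq_monotone F (Fin.le_last i)
    rw [spacetimeSeq, initialLength_zero] at h1
    rw [spacetimeSeq.eq_1 F (Fin.last m), initialLength_last, h] at h2
    exact ⟨h1, h2⟩⟩⟩

theorem causalSeq_strictMono (hF : IsSeq F) (h : seqLength F = ℓ) :
    StrictMono (causalSeq F h) := by
  refine Fin.strictMono_iff_lt_succ.2 fun i => lt_of_le_of_ne ?_ fun he => hF i ?_
  · exact Sigma.LE.fiber _ _ _ (spacetimeSeq_monotone F i.castSucc_lt_succ.le)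
  · exact congrArg TotalCausal.point he

theorem causalSeq_null (h : seqLength F = ℓ) (i : Fin m) :
    TotalCausal.Null (causalSeq F h i.castSucc) (causalSeq F h i.succ) := by
  change dist (F i.castSucc) (F i.succ) = initialLength F i.succ - initialLength F i.castSucc
  rw [initialLength_succ]
  ring

open TotalCausal in
-- A null pair straddling a point of the chain would restrict to the two neighbours of that point
-- and make it smooth in `F`. Hence null pairs are consecutive, and a gap point would project into
-- an empty interval `I(a_{i-1}, a_i)`.
theorem causalSeq_isCritical (hF : IsThinFrame F) (h : seqLength F = ℓ)
    {σ : Finset (TotalCausal X ℓ)} (hσ : (σ : Set _) = Set.range (causalSeq F h)) :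
    IsCritical Null σ := by
  have hz := causalSeq_strictMono hF.1.1 h
  have hmem : ∀ v, v ∈ σ ↔ ∃ i, causalSeq F h i = v := fun v => by
    rw [← Finset.mem_coe, hσ]; rfl
  have hsing : ∀ i j k : Fin (m + 1), i < k → k < j →
      ¬ Null (causalSeq F h i) (causalSeq F h j) := by
    intro i j k hik hkj hN
    have hi : (i : ℕ) < k := hik
    have hj : (k : ℕ) < j := hkj
    let i' : Fin m := ⟨k - 1, by omega⟩
    let j' : Fin m := ⟨k, by omega⟩
    have hi' : i'.succ = k := Fin.ext (by simp [i']; omega)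
    have hj' : j'.castSucc = k := Fin.ext rfl
    have h1 : i ≤ i'.castSucc := by rw [Fin.le_def]; simp [i']; omega
    have h2 : i'.castSucc ≤ j'.succ := by rw [Fin.le_def]; simp [i', j']; omega
    have h3 : j'.succ ≤ j := by rw [Fin.le_def]; simp [j']; omega
    have hN' : Null (causalSeq F h i'.castSucc) (causalSeq F h j'.succ) :=
      (hN.left (hz.monotone (h1.trans h2)) (hz.monotone h3)).right
        (hz.monotone h1) (hz.monotone h2)
    have n1 := causalSeq_null h i'
    have n2 := causalSeq_null h j'
    rw [hi'] at n1
    rw [hj'] at n2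
    refine hF.1.2 k ⟨i'.castSucc, j'.succ, by simp [i']; omega, by simp [j'], ?_⟩
    unfold Null at n1 n2 hN'
    change dist (F _) (F _) = _ at n1 n2 hN'
    linarith
  refine ⟨(isFull_iff hz hσ).2 h, fun v hv => ⟨hv, ?_⟩, ?_⟩
  · intro u hu w hw huv hvw
    obtain ⟨k, rfl⟩ := (hmem v).1 hv
    obtain ⟨i, rfl⟩ := (hmem u).1 hu
    obtain ⟨j, rfl⟩ := (hmem w).1 hw
    exact hsing i j k (hz.lt_iff_lt.1 huv) (hz.lt_iff_lt.1 hvw)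
  · rintro p ⟨u, hu, w, hw, hup, hpw, hN⟩
    obtain ⟨i, rfl⟩ := (hmem u).1 hu
    obtain ⟨j, rfl⟩ := (hmem w).1 hw
    have hij : (i : ℕ) < j := hz.lt_iff_lt.1 (hup.trans hpw)
    obtain ⟨i', rfl⟩ : ∃ i' : Fin m, i'.castSucc = i := ⟨⟨i, by omega⟩, rfl⟩
    obtain rfl : i'.succ = j := by
      by_contra hne
      refine hsing _ j i'.succ i'.castSucc_lt_succ ?_ hN
      rw [Fin.ext_iff] at hne
      rw [Fin.lt_def]
      simp only [Fin.val_succ, Fin.val_castSucc] at hne hij ⊢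
      omega
    have hp1 := hN.left hup.le hpw.le
    have hp2 := hN.right hup.le hpw.le
    have hne1 := hp1.point_ne hup
    have hne2 := hp2.point_ne hpw
    have : p.point ∈ openInterval (F i'.castSucc) (F i'.succ) := by
      refine ⟨?_, ?_⟩
      · unfold Null at hp1 hp2 hN
        change dist (F i'.castSucc) _ = _ at hp1
        change dist _ (F i'.succ) = _ at hp2
        change dist (F i'.castSucc) (F i'.succ) = _ at hN
        change dist (F i'.castSucc) _ + dist _ (F i'.succ) = dist (F i'.castSucc) (F i'.succ)
        linarith
      · rintro (h' | h')
        · exact hne1 h'.symm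
        · exact hne2 h'
    rw [hF.2 i'] at this
    exact this

open TotalCausal in
theorem exists_causalSeq_of_isCritical {σ : Finset (TotalCausal X ℓ)}
    (hσ : IsCritical Null σ) :
    ∃ (m : ℕ) (F : Fin (m + 1) → X) (h : seqLength F = ℓ), IsThinFrame F ∧
      (σ : Set _) = Set.range (causalSeq F h) := by
  obtain ⟨n, z, hz, hr⟩ := exists_strictMono_of_isChain hσ.full.chain
    (hσ.full.exists_isMin.imp fun _ h => h.1)
  have hmem : ∀ i, z i ∈ σ := fun i => by
    rw [← Finset.mem_coe, hr]; exact ⟨i, rfl⟩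
  have hrange : ∀ v, v ∈ σ → ∃ i, z i = v := fun v hv => by
    rw [← Finset.mem_coe, hr] at hv; exact hv
  have hlen := (isFull_iff hz hr).1 hσ.full
  have hnull : ∀ i : Fin n, Null (z i.castSucc) (z i.succ) := by
    intro i
    refine hσ.full.step _ (hmem _) _ (hmem _) (hz i.castSucc_lt_succ) fun v hv h1 h2 => ?_
    obtain ⟨k, rfl⟩ := hrange v hv
    rw [hz.lt_iff_lt, Fin.lt_def] at h1 h2
    simp only [Fin.val_castSucc, Fin.val_succ] at h1 h2
    omega
  have h0 : (z 0).time = 0 := by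
    obtain ⟨u, hu, hmin⟩ := hσ.full.exists_isMin
    obtain ⟨i, rfl⟩ := hrange u hu
    rwa [← hmin.eq_of_le (hz.monotone (Fin.zero_le i)), isMin_iff] at hmin
  have hl : (z (Fin.last n)).time = ℓ := by
    obtain ⟨u, hu, hmax⟩ := hσ.full.exists_isMax
    obtain ⟨i, rfl⟩ := hrange u hu
    rwa [hmax.eq_of_le (hz.monotone (Fin.le_last i)), isMax_iff] at hmax
  -- Since the chain starts at time `0` with null steps, its times are determined by its points.
  have htime : ∀ i, (z i).time = initialLength (fun i => (z i).point) i := by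
    intro i
    induction i using Fin.induction with
    | zero => rw [h0, initialLength_zero]
    | succ i ih =>
      rw [initialLength_succ, ← ih, hnull i]
      ring
  have hzF : z = causalSeq (fun i => (z i).point) hlen := by
    funext i
    refine ext' (Prod.ext ?_ ?_) rfl (htime i)
    · rw [← (le_iff.1 (hz.monotone (Fin.zero_le i))).1]
      exact (point_eq_fst h0).symm
    · rw [(le_iff.1 (hz.monotone (Fin.le_last i))).1]
      exact (point_eq_snd hl).symm
  refine ⟨n, fun i => (z i).point, hlen, ⟨⟨fun i => ?_, ?_⟩, fun i => ?_⟩, by rw [← hzF, hr]⟩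
  · exact (hnull i).point_ne (hz i.castSucc_lt_succ)
  · rintro k ⟨i, j, hik, hkj, hd⟩
    have hi : i < k := by rw [Fin.lt_def]; omega
    have hj : k < j := by rw [Fin.lt_def]; omega
    refine (hσ.singular (z k) (hmem k)).2 _ (hmem i) _ (hmem j) (hz hi) (hz hj) ?_
    have n1 := hnull ⟨i, by omega⟩
    have n2 := hnull ⟨k, by omega⟩
    have e1 : (⟨i, by omega⟩ : Fin n).succ = k := Fin.ext (by simpa using hik)
    have e2 : (⟨k, by omega⟩ : Fin n).succ = j := Fin.ext (by simpa using hkj)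
    rw [e1] at n1
    rw [e2] at n2
    unfold Null at *
    change dist (z i).point _ = _ - (z i).time at n1
    change dist (z k).point _ = _ - (z k).time at n2
    linarith
  · refine Set.eq_empty_of_forall_notMem ?_
    rintro x ⟨hx, hne⟩
    have hx' : dist (z i.castSucc).point x + dist x (z i.succ).point =
      dist (z i.castSucc).point (z i.succ).point := hx
    have hN := hnull i
    have hfib := (le_iff.1 (hz i.castSucc_lt_succ).le).1
    -- A point of the open interval is lifted to the time that makes it null related to the lower
    -- end; it then lies in a gap.
    let q : Spacetime X := ⟨x, (z i.castSucc).time + dist (z i.castSucc).point x⟩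
    have hq1 : (z i.castSucc).2.1 ≤ q := by
      change dist (z i.castSucc).point x ≤
        (z i.castSucc).time + dist (z i.castSucc).point x - (z i.castSucc).time
      linarith
    have hq2 : q ≤ (z i.succ).2.1 := by
      change dist x (z i.succ).point ≤
        (z i.succ).time - ((z i.castSucc).time + dist (z i.castSucc).point x)
      unfold Null at hN
      linarith
    have hb : (z i.succ).2.1 ≤ ⟨(z i.castSucc).1.2, ℓ⟩ := by
      rw [hfib]; exact (z i.succ).2.2.2
    let p : TotalCausal X ℓ :=
      ⟨(z i.castSucc).1, ⟨q, (z i.castSucc).2.2.1.trans hq1, hq2.trans hb⟩⟩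
    have hp1 : z i.castSucc ≤ p := le_iff.2 ⟨rfl, hq1⟩
    have hp2 : p ≤ z i.succ := le_iff.2 ⟨hfib, hq2⟩
    refine hσ.no_gap p ⟨_, hmem i.castSucc, _, hmem i.succ, lt_of_le_of_ne hp1 ?_,
      lt_of_le_of_ne hp2 ?_, hN⟩
    · intro he
      exact hne (Or.inl (congrArg point he).symm)
    · intro he
      exact hne (Or.inr (congrArg point he))

theorem range_injective_of_strictMono {P : Type*} [PartialOrder P] {n k : ℕ}
    {y : Fin (n + 1) → P} {z : Fin (k + 1) → P} (hy : StrictMono y) (hz : StrictMono z)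
    (h : Set.range y = Set.range z) : ∃ e : n = k, y = z ∘ Fin.cast (by rw [e]) := by
  have hc : n + 1 = k + 1 := by
    have h1 := Set.ncard_range_of_injective hy.injective
    have h2 := Set.ncard_range_of_injective hz.injective
    rw [h, h2] at h1
    simpa using h1.symm
  obtain rfl : n = k := by omega
  refine ⟨rfl, ?_⟩
  have hex : ∀ i, ∃ j, z j = y i := fun i => by
    have : y i ∈ Set.range z := h ▸ ⟨i, rfl⟩
    exact this
  choose g hg using hex
  have hmono : StrictMono g := fun i j hij => by
    rw [← hz.lt_iff_lt, hg, hg]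
    exact hy hij
  have hid : g = id := by
    rw [← StrictMono.range_inj hmono strictMono_id, Set.range_id]
    exact (Finite.injective_iff_surjective.1 hmono.injective).range_eq
  funext i
  rw [← hg i, hid]
  rfl

/-- The critical chain of a thin frame. -/
def ThinFrame.vertices (F : ThinFrame X ℓ) : Fin (F.1 + 1) ↪ TotalCausal X ℓ :=
  ⟨causalSeq F.2.1 F.2.2.2, (causalSeq_strictMono F.2.2.1.1.1 F.2.2.2).injective⟩

theorem ThinFrame.coe_vertexSet (F : ThinFrame X ℓ) :
    (vertexSet F.vertices : Set (TotalCausal X ℓ)) = Set.range (causalSeq F.2.1 F.2.2.2) := by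
  simp [vertices]

theorem ThinFrame.vertexSet_injective {F G : ThinFrame X ℓ}
    (h : vertexSet F.vertices = vertexSet G.vertices) : F = G := by
  have hr : Set.range (causalSeq F.2.1 F.2.2.2) = Set.range (causalSeq G.2.1 G.2.2.2) := by
    rw [← F.coe_vertexSet, ← G.coe_vertexSet, h]
  obtain ⟨m, F, hF, hFl⟩ := F
  obtain ⟨n, G, hG, hGl⟩ := G
  obtain ⟨e, he⟩ := range_injective_of_strictMono (causalSeq_strictMono hF.1.1 hFl)
    (causalSeq_strictMono hG.1.1 hGl) hr
  obtain rfl : m = n := e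
  have : F = G := funext fun i => congrArg TotalCausal.point (congrFun he i)
  subst this
  rfl

open Classical in
theorem coneMatching_totalCausal [Nonempty (TotalCausal X ℓ)] (hcut : fourCutInf X = ⊤)
    (htot : ∀ (a b : X) (x y : IntervalPoset a b), x ≤ y ∨ y ≤ x) :
    ConeMatching (orderComplex (TotalCausal X ℓ)) (shortComplex X ℓ)
      (fun F : ThinFrame X ℓ => F.1) ThinFrame.vertices (gapPoint TotalCausal.Null) := by
  refine coneMatching_of_isNullRel (TotalCausal.isNullRel_null hcut htot)
    (fun σ hσ => TotalCausal.notMem_shortComplex_iff hσ)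
    (fun F => causalSeq_isCritical F.2.2.1 F.2.2.2 F.coe_vertexSet)
    (fun F G => ThinFrame.vertexSet_injective) fun σ hσ => ?_
  obtain ⟨m, F, h, hF, hr⟩ := exists_causalSeq_of_isCritical hσ
  let G : ThinFrame X ℓ := ⟨m, F, hF, h⟩
  exact ⟨G, Finset.coe_injective (hr.trans G.coe_vertexSet.symm)⟩

theorem Collapse.subsingleton {Y : Type*} [IsEmpty Y] (A : Set Y) : Subsingleton (Collapse A) :=
  ⟨Collapse.ind isEmptyElim (Collapse.ind isEmptyElim rfl)⟩

theorem nonempty_homotopyEquiv_thinFrameWedge (hcut : fourCutInf X = ⊤)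
    (htot : ∀ (a b : X) (x y : IntervalPoset a b), x ≤ y ∨ y ≤ x) :
    Nonempty (ContinuousMap.HomotopyEquiv (MagnitudeHomotopyType X ℓ) (ThinFrameWedge X ℓ)) := by
  classical
  cases isEmpty_or_nonempty (TotalCausal X ℓ) with
  | inr _ => exact ⟨(coneMatching_totalCausal hcut htot).homotopyEquiv⟩
  -- `gapPoint` needs a nonempty poset; if there is none, both spaces consist of the base point
  -- alone.
  | inl _ =>
    have : IsEmpty (ThinFrame X ℓ) := ⟨fun F => isEmptyElim (F.vertices 0)⟩
    have : IsEmpty (Realization (orderComplex (TotalCausal X ℓ))) :=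
      ⟨fun p => isEmptyElim (face_nonempty p.support_mem).choose⟩
    have h1 : Subsingleton (MagnitudeHomotopyType X ℓ) := Collapse.subsingleton _
    have h2 : Subsingleton (ThinFrameWedge X ℓ) := Collapse.subsingleton _
    refine ⟨⟨.const _ (SphereWedge.pt _), .const _ (Collapse.pt _), ?_, ?_⟩⟩
    · rw [show ContinuousMap.comp _ _ = ContinuousMap.id (MagnitudeHomotopyType X ℓ) from
        ContinuousMap.ext fun _ => Subsingleton.elim _ _]
    · rw [show ContinuousMap.comp _ _ = ContinuousMap.id (ThinFrameWedge X ℓ) from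
        ContinuousMap.ext fun _ => Subsingleton.elim _ _]

end ThinFrames

/-! ### Subsets of Euclidean spaces and trees -/

/-- In a `4`-cut, the first three and the last three points satisfy equality in the triangle
inequality, but the four points together do not. Spaces in which such equalities concatenate have no
`4`-cuts. -/
theorem fourCutInf_eq_top_of_forall {X : Type*} [MetricSpace X]
    (h : ∀ a b c d : X, b ≠ c → dist a b + dist b c = dist a c →
      dist b c + dist c d = dist b d → dist a b + dist b c + dist c d = dist a d) :
    fourCutInf X = ⊤ := by
  refine iInf₂_eq_top.2 fun x hx => ?_
  obtain ⟨hseq, hlt, h1, h2⟩ := hx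
  have hne : x 1 ≠ x 2 := hseq 1
  have hlen : seqLength x = dist (x 0) (x 1) + dist (x 1) (x 2) + dist (x 2) (x 3) := by
    simp [seqLength, Fin.sum_univ_succ]
    ring
  have h1' : seqLength ![x 0, x 2, x 3] = dist (x 0) (x 2) + dist (x 2) (x 3) := by
    simp [seqLength, Fin.sum_univ_succ]
  have h2' : seqLength ![x 0, x 1, x 3] = dist (x 0) (x 1) + dist (x 1) (x 3) := by
    simp [seqLength, Fin.sum_univ_succ]
  have := h (x 0) (x 1) (x 2) (x 3) hne (by linarith) (by linarith)
  linarith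

/-! ### Subsets of strictly convex spaces. -/

section Euclidean

variable {E : Type*} [NormedAddCommGroup E] [NormedSpace ℝ E] [StrictConvexSpace ℝ E]

/-- By strict convexity, equality in the triangle inequality means lying on the segment, and
segments overlapping in `b ≠ c` extend each other. -/
theorem fourCutInf_subset_eq_top (X : Set E) : fourCutInf X = ⊤ := by
  refine fourCutInf_eq_top_of_forall fun a b c d hbc h1 h2 => ?_
  simp only [Subtype.dist_eq] at *
  have h3 := (dist_add_dist_eq_iff.1 h1).trans_expand_left (dist_add_dist_eq_iff.1 h2)
    (Subtype.coe_injective.ne hbc)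
  have := dist_add_dist_eq_iff.2 h3
  linarith

/-- The interval lies on a segment and is ordered by the segment's parameter. -/
theorem intervalPoset_subset_total (X : Set E) (a b : X) (x y : IntervalPoset a b) :
    x ≤ y ∨ y ≤ x := by
  have hx : dist (a : E) x.1 + dist (x.1 : E) b = dist (a : E) b := x.2
  have hy : dist (a : E) y.1 + dist (y.1 : E) b = dist (a : E) b := y.2
  obtain ⟨s, hs, hsx⟩ := dist_add_dist_eq_iff.1 hx
  obtain ⟨t, ht, hty⟩ := dist_add_dist_eq_iff.1 hy
  have hax : dist (a : E) x.1 = s * dist (a : E) b := by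
    rw [← hsx, dist_left_lineMap, Real.norm_of_nonneg hs.1]
  have hay : dist (a : E) y.1 = t * dist (a : E) b := by
    rw [← hty, dist_left_lineMap, Real.norm_of_nonneg ht.1]
  have hxy : dist (x.1 : E) y.1 = |s - t| * dist (a : E) b := by
    rw [← hsx, ← hty, dist_lineMap_lineMap, Real.dist_eq]
  rcases le_total s t with h | h
  · left
    change dist (a : E) x.1 + dist (x.1 : E) y.1 + dist (y.1 : E) b = dist (a : E) b
    rw [abs_of_nonpos (sub_nonpos.2 h)] at hxy
    linarith
  · right
    change dist (a : E) y.1 + dist (y.1 : E) x.1 + dist (x.1 : E) b = dist (a : E) b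
    rw [abs_of_nonneg (sub_nonneg.2 h)] at hxy
    rw [dist_comm (y.1 : E)]
    linarith

end Euclidean

/-! ### Trees with the shortest-path metric. -/

section Tree

variable {V : Type*} {G : SimpleGraph V}

theorem dist_add_dist_add_dist_of_isTree (hG : G.IsTree) {a b c d : V} (hbc : b ≠ c)
    (h1 : G.dist a b + G.dist b c = G.dist a c) (h2 : G.dist b c + G.dist c d = G.dist b d) :
    G.dist a b + G.dist b c + G.dist c d = G.dist a d := by
  obtain ⟨p, hp⟩ := hG.connected.exists_walk_length_eq_dist a b
  obtain ⟨q, hq⟩ := hG.connected.exists_walk_length_eq_dist b c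
  obtain ⟨r, hr⟩ := hG.connected.exists_walk_length_eq_dist c d
  have hpq : (p.append q).IsPath :=
    (p.append q).isPath_of_length_eq_dist (by rw [SimpleGraph.Walk.length_append]; omega)
  have hqr : (q.append r).IsPath :=
    (q.append r).isPath_of_length_eq_dist (by rw [SimpleGraph.Walk.length_append]; omega)
  have hne : q.edges ≠ [] := by
    intro h
    have : q.length = 0 := by rw [← q.length_edges, h]; rfl
    exact hbc (SimpleGraph.Walk.eq_of_length_eq_zero this)
  -- In an acyclic graph, a walk is a path as soon as no two consecutive edges agree. This condition
  -- is local, so it passes to the concatenation because the overlap `q` has an edge.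
  have hpath : ((p.append q).append r).IsPath := by
    rw [hG.isAcyclic.isPath_iff_isChain, SimpleGraph.Walk.edges_append] at *
    rw [SimpleGraph.Walk.edges_append]
    exact List.IsChain.append_overlap hpq hqr hne
  obtain ⟨w, hw, hlen⟩ := hG.connected.exists_path_of_dist a d
  rw [← hlen, (hG.existsUnique_path a d).unique hw hpath]
  simp only [SimpleGraph.Walk.length_append]
  omega

theorem interval_total_of_isTree (hG : G.IsTree) {a b x y : V}
    (hx : G.dist a x + G.dist x b = G.dist a b) (hy : G.dist a y + G.dist y b = G.dist a b)
    (hxy : G.dist a x ≤ G.dist a y) : G.dist a x + G.dist x y + G.dist y b = G.dist a b := by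
  obtain ⟨p, hp⟩ := hG.connected.exists_walk_length_eq_dist a x
  obtain ⟨q, hq⟩ := hG.connected.exists_walk_length_eq_dist x b
  obtain ⟨r, hr⟩ := hG.connected.exists_walk_length_eq_dist a y
  obtain ⟨s, hs⟩ := hG.connected.exists_walk_length_eq_dist y b
  have h : p.append q = r.append s := (hG.existsUnique_path a b).unique
    ((p.append q).isPath_of_length_eq_dist (by rw [SimpleGraph.Walk.length_append]; omega))
    ((r.append s).isPath_of_length_eq_dist (by rw [SimpleGraph.Walk.length_append]; omega))
  -- Both concatenations are the unique path from `a` to `b`. As `y` is not closer to `a` than `x`,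
  -- it lies on the part `q` after `x`.
  have hy' : q.getVert (r.length - p.length) = y := by
    have h1 := congrArg (fun w => w.getVert r.length) h
    simp only [SimpleGraph.Walk.getVert_append] at h1
    rw [if_neg (by omega), if_neg (by omega)] at h1
    simpa using h1
  have h2 := SimpleGraph.dist_le (q.take (r.length - p.length))
  rw [SimpleGraph.Walk.take_length, hy'] at h2
  have h5 := hG.connected.dist_triangle (u := a) (v := x) (w := y)
  omega

theorem fourCutInf_eq_top_of_isTree [MetricSpace V] (hG : G.IsTree)
    (hd : ∀ x y : V, dist x y = (G.dist x y : ℝ)) : fourCutInf V = ⊤ := by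
  refine fourCutInf_eq_top_of_forall fun a b c d hbc h1 h2 => ?_
  simp only [hd] at *
  exact_mod_cast dist_add_dist_add_dist_of_isTree hG hbc (by exact_mod_cast h1)
    (by exact_mod_cast h2)

theorem intervalPoset_total_of_isTree [MetricSpace V] (hG : G.IsTree)
    (hd : ∀ x y : V, dist x y = (G.dist x y : ℝ)) (a b : V) (x y : IntervalPoset a b) :
    x ≤ y ∨ y ≤ x := by
  have hx : dist a x.1 + dist x.1 b = dist a b := x.2
  have hy : dist a y.1 + dist y.1 b = dist a b := y.2
  simp only [hd] at hx hy
  norm_cast at hx hy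
  rcases le_total (G.dist a x.1) (G.dist a y.1) with h | h
  · left
    change dist a x.1 + dist x.1 y.1 + dist y.1 b = dist a b
    simp only [hd]
    exact_mod_cast interval_total_of_isTree hG hx hy h
  · right
    change dist a y.1 + dist y.1 x.1 + dist x.1 b = dist a b
    simp only [hd]
    exact_mod_cast interval_total_of_isTree hG hy hx h

end Tree

end MagnitudeHomotopy

end

theorem mainTheorem12 :
    (∀ (X : Type*) [MetricSpace X],
      MagnitudeHomotopy.fourCutInf X = ⊤ →
      (∀ (a b : X) (x y : MagnitudeHomotopy.IntervalPoset a b), x ≤ y ∨ y ≤ x) →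
      ∀ ℓ : ℝ, 0 ≤ ℓ →
        Nonempty (ContinuousMap.HomotopyEquiv
          (MagnitudeHomotopy.MagnitudeHomotopyType X ℓ)
          (MagnitudeHomotopy.ThinFrameWedge X ℓ))) ∧
    (∀ (n : ℕ) (X : Set (EuclideanSpace ℝ (Fin n))),
      MagnitudeHomotopy.fourCutInf X = ⊤ ∧
      (∀ (a b : X) (x y : MagnitudeHomotopy.IntervalPoset a b), x ≤ y ∨ y ≤ x) ∧
      ∀ ℓ : ℝ, 0 ≤ ℓ →
        Nonempty (ContinuousMap.HomotopyEquiv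
          (MagnitudeHomotopy.MagnitudeHomotopyType X ℓ)
          (MagnitudeHomotopy.ThinFrameWedge X ℓ))) ∧
    (∀ (V : Type*) [MetricSpace V] (G : SimpleGraph V), G.IsTree →
      (∀ x y : V, dist x y = (G.dist x y : ℝ)) →
      MagnitudeHomotopy.fourCutInf V = ⊤ ∧
      (∀ (a b : V) (x y : MagnitudeHomotopy.IntervalPoset a b), x ≤ y ∨ y ≤ x) ∧
      ∀ ℓ : ℝ, 0 ≤ ℓ →
        Nonempty (ContinuousMap.HomotopyEquiv
          (MagnitudeHomotopy.MagnitudeHomotopyType V ℓ)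
          (MagnitudeHomotopy.ThinFrameWedge V ℓ))) := by
  refine ⟨fun X _ hcut htot ℓ _ =>
    MagnitudeHomotopy.nonempty_homotopyEquiv_thinFrameWedge hcut htot, fun n X => ?_, ?_⟩
  · have hcut := MagnitudeHomotopy.fourCutInf_subset_eq_top X
    have htot := MagnitudeHomotopy.intervalPoset_subset_total X
    exact ⟨hcut, htot, fun ℓ _ =>
      MagnitudeHomotopy.nonempty_homotopyEquiv_thinFrameWedge hcut htot⟩
  · intro V _ G hG hd
    have hcut := MagnitudeHomotopy.fourCutInf_eq_top_of_isTree hG hd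
    have htot := MagnitudeHomotopy.intervalPoset_total_of_isTree hG hd
    exact ⟨hcut, htot, fun ℓ _ =>
      MagnitudeHomotopy.nonempty_homotopyEquiv_thinFrameWedge hcut htot⟩
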